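/- Let $n>1$ be an integer and $\alpha>-1$. Let $\mathbb B$ be the open unit ball of $\mathbb C^n$ with $\langle z,w\rangle=\sum_j z_j\overline{w_j}$ and $|z|=\langle z,z\rangle^{1/2}$, let $v$ be Lebesgue measure on $\mathbb B$ normalized so that $v(\mathbb B)=1$, and let $dv_\alpha(z)=c_\alpha(1-|z|^2)^\alpha\,dv(z)$, where $c_\alpha$ is chosen so that $v_\alpha(\mathbb B)=1$. The weighted Bergman projection is $$P_\alpha g(z)=\int_{\mathbb B}\frac{g(w)}{(1-\langle z,w\rangle)^{n+1+\alpha}}\,dv_\alpha(w),\qquad z\in\mathbb B,\ g\in L^\infty(\mathbb B).$$ For $a\in\mathbb B\setminus\{0\}$ let $$\varphi_a(\omega)=\frac{a-\frac{\langle\omega,a\rangle}{|a|^2}a-(1-|a|^2)^{1/2}\bigl(\omega-\frac{\langle\omega,a\rangle}{|a|^2}a\bigr)}{1-\langle\omega,a\rangle},$$ and let $\varphi_0=-\mathrm{Id}$; these are automorphisms of $\mathbb B$ with $\varphi_a(0)=a$. For $f$ holomorphic in $\mathbb B$ let $\tilde\nabla f(z)=\nabla(f\circ\varphi_z)(0)$,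 where $\nabla=(\partial/\partial z_1,\dots,\partial/\partial z_n)$, and let $\|f\|_{\tilde\beta}=\sup_{z\in\mathbb B}|\tilde\nabla f(z)|$. The Bloch space $\mathcal B$ consists of the holomorphic $f$ in $\mathbb B$ with $\|f\|_{\tilde\beta}<\infty$. Put $$C_{\alpha,n}=\frac{\Gamma(2+n+\alpha)}{\Gamma\bigl((2+n+\alpha)/2\bigr)^2},\qquad \ell(t)=(n+1+\alpha)\int_{\mathbb B}\frac{|(1-w_1)\cos t+w_2\sin t|}{|w_1-1|^{n+1+\alpha}}\,dv_\alpha(w).$$ Then $$\ell(\pi/2)=\frac{\pi}{2}\,\ell(0)=\frac{\pi}{2}\,C_{\alpha,n}.$$ Moreover, $P_\alpha$ maps $L^\infty(\mathbb B)$ into $\mathcal B$, its norm $\|P_\alpha\|_{\tilde\beta}=\sup\{\|P_\alpha g\|_{\tilde\beta}:\ \|g\|_\infty\le 1\}$ is finite, and $$\|P_\alpha\|_{\tilde\beta}=\max_{0\le t\le\pi/2}\ell(t)$$ (in particular the maximum is attained), and $$\frac{\pi}{2}\,C_{\alpha,n}\le\|P_\alpha\|_{\tilde\beta}\le\frac{\sqrt{\pi^2+4}}{2}\,C_{\alpha,n}.$$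 -/

import Mathlib

open MeasureTheory
open scoped ENNReal

noncomputable section

namespace BergmanBloch

/-- The complex Euclidean space `ℂⁿ`. -/
abbrev Cn (n : ℕ) : Type := EuclideanSpace ℂ (Fin n)

/-- The open unit ball of `ℂⁿ`. -/
def unitBall (n : ℕ) : Set (Cn n) := Metric.ball 0 1

/-- The inner product `⟨z, w⟩ = ∑ j, z_j * conj w_j`, linear in the first variable
(Mathlib's inner product is linear in the second one). -/
def pairing {n : ℕ} (z w : Cn n) : ℂ := inner ℂ w z

/-- Lebesgue measure on the unit ball, normalized to total mass one. -/
def ballMeasure (n : ℕ) : Measure (Cn n) :=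
  (volume (unitBall n))⁻¹ • volume.restrict (unitBall n)

/-- The constant making `c (1 - |z|²)^α dv(z)` a probability measure on the ball. -/
def weightConst (n : ℕ) (α : ℝ) : ℝ :=
  (∫ z, (1 - ‖z‖ ^ 2) ^ α ∂(ballMeasure n))⁻¹

/-- The weighted measure `dv_α(z) = c_α (1 - |z|²)^α dv(z)` on the ball. -/
def weightedMeasure (n : ℕ) (α : ℝ) : Measure (Cn n) :=
  (ballMeasure n).withDensity
    fun z => ENNReal.ofReal (weightConst n α * (1 - ‖z‖ ^ 2) ^ α)

/-- The weighted Bergman kernel `(1 - ⟨z, w⟩)^{-(n+1+α)}`; for `z`, `w` in the ball the base has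
positive real part and the power is the principal one. -/
def bergmanKernel {n : ℕ} (α : ℝ) (z w : Cn n) : ℂ :=
  1 / (1 - pairing z w) ^ ((n : ℂ) + 1 + (α : ℂ))

/-- The weighted Bergman projection `P_α g`. -/
def bergmanProj {n : ℕ} (α : ℝ) (g : Cn n → ℂ) (z : Cn n) : ℂ :=
  ∫ w, bergmanKernel α z w * g w ∂(weightedMeasure n α)

/-- The involutive automorphism `φ_a` of the ball exchanging `0` and `a` (`φ_0 = -id`). -/
def ballInvolution {n : ℕ} (a ω : Cn n) : Cn n :=
  if a = 0 then -ω
  else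
    (1 / (1 - pairing ω a)) •
      (a - (pairing ω a / ((‖a‖ ^ 2 : ℝ) : ℂ)) • a
        - ((Real.sqrt (1 - ‖a‖ ^ 2) : ℝ) : ℂ) •
            (ω - (pairing ω a / ((‖a‖ ^ 2 : ℝ) : ℂ)) • a))

/-- The complex gradient `(∂f/∂z_1, …, ∂f/∂z_n)`. -/
def complexGradient {n : ℕ} (f : Cn n → ℂ) (z : Cn n) : Cn n :=
  WithLp.toLp 2 fun j => fderiv ℂ f z (EuclideanSpace.single j 1)

/-- The invariant gradient `∇(f ∘ φ_z)(0)`. -/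
def invariantGradient {n : ℕ} (f : Cn n → ℂ) (z : Cn n) : Cn n :=
  complexGradient (fun ω => f (ballInvolution z ω)) 0

/-- The invariant Bloch seminorm, the supremum over the ball of `|∇(f ∘ φ_z)(0)|`,
as an extended nonnegative real. -/
def invariantBlochSeminorm {n : ℕ} (f : Cn n → ℂ) : ℝ≥0∞ :=
  ⨆ z ∈ unitBall n, ‖invariantGradient f z‖ₑ

/-- The (restriction to the ball of the) function `f` belongs to the Bloch space. -/
def MemBloch {n : ℕ} (f : Cn n → ℂ) : Prop :=
  DifferentiableOn ℂ f (unitBall n) ∧ invariantBlochSeminorm f < ∞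

/-- The norm of `P_α` from `L^∞` of the ball to the Bloch space with the invariant seminorm:
the supremum of the seminorms of `P_α g` over all `g` in `L^∞` with `‖g‖_∞ ≤ 1`. -/
def bergmanProjNorm (n : ℕ) (α : ℝ) : ℝ≥0∞ :=
  ⨆ (g : Cn n → ℂ) (_ : MemLp g ∞ (ballMeasure n)) (_ : eLpNorm g ∞ (ballMeasure n) ≤ 1),
    invariantBlochSeminorm (bergmanProj α g)

/-- The constant `C_{α,n} = Γ(2+n+α) / Γ((2+n+α)/2)²`. -/
def blochConst (n : ℕ) (α : ℝ) : ℝ :=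
  Real.Gamma (2 + n + α) / Real.Gamma ((2 + n + α) / 2) ^ 2

/-- The function `ℓ(t)`; the coordinates `w_1`, `w_2` have indices `0`, `1` in `Fin n`. -/
def ell {n : ℕ} (hn : 1 < n) (α t : ℝ) : ℝ :=
  (n + 1 + α) *
    ∫ w, ‖(1 - w ⟨0, Nat.zero_lt_of_lt hn⟩) * (Real.cos t : ℂ) + w ⟨1, hn⟩ * (Real.sin t : ℂ)‖ /
      ‖w ⟨0, Nat.zero_lt_of_lt hn⟩ - 1‖ ^ ((n : ℝ) + 1 + α) ∂(weightedMeasure n α)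

end BergmanBloch

end

noncomputable section

namespace BergmanBloch

open Set Filter Topology
open scoped ComplexConjugate

/-! Fix `a` in the ball and a unit vector `ξ`. Differentiating under the integral, the derivative of
`P_α g ∘ φ_a` at 0 along `ξ` is the integral of `g` against an explicit kernel, so by duality its
largest modulus over `‖g‖_∞ ≤ 1` is the L¹ norm of that kernel (`gradientMass_le_bergmanProjNorm`,
`enorm_invariantGradient_bergmanProj_le`). The substitution `w = φ_a(η)` turns this norm into
`gradientMass α a ξ`, that is `(n+1+α) ∫ |⟨η-a,ξ⟩| / |1-⟨η,a⟩|^(n+1+α) dv_α(η)`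
(`lintegral_norm_kernelDeriv`). The norm of `P_α` is thus the supremum of `gradientMass` over the
ball and the unit vectors.

This expression makes sense for `|a| = 1` too, and the supremum may be taken there. For fixed `η`
the integrand is the modulus of a holomorphic function of `a`, hence has the sub-mean value property
on complex lines. As `n > 1`, there is a complex line through `a` orthogonal to `a`, and the circle
of radius `√(1-|a|²)` about `a` in it lies on the sphere. So an interior value is at most an average
of boundary values (`gradientMass_le_of_sphere`). Conversely, Fatou's lemma along `rζ → ζ` shows
that boundary values do not exceed the norm (`gradientMass_sphere_le_bergmanProjNorm`).

At a boundary point `ζ`, unitary invariance leaves only the angle between `ξ` and `ζ`: the value is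
`ell t` with `cos t = |⟨ξ,ζ⟩|` (`gradientMass_sphere`). Since `ell` is continuous, it has a maximum
on `[0, π/2]`.

The values at 0 and `π/2` come from integrating out all coordinates but the first and using polar
coordinates of the disc centred at the boundary point 1; both reduce to Beta functions times the
same integral `cosIntegral (n + α)`. The lower bound is the value at `π/2`; the upper bound follows
from `ell t ≤ |cos t| ell 0 + |sin t| ell (π/2)` and the Cauchy-Schwarz inequality. -/

/-! ### Truncated powers and Beta integrals on the line. -/

/-- The truncated power `x₊ᵖ`, equal to `x ^ p` for `x > 0` and to `0` otherwise. -/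
def posRpow (p x : ℝ) : ℝ≥0∞ := if 0 < x then ENNReal.ofReal (x ^ p) else 0

lemma posRpow_of_pos {p x : ℝ} (hx : 0 < x) : posRpow p x = ENNReal.ofReal (x ^ p) := if_pos hx

lemma posRpow_of_nonpos {p x : ℝ} (hx : x ≤ 0) : posRpow p x = 0 := if_neg hx.not_gt

@[fun_prop]
lemma measurable_posRpow (p : ℝ) : Measurable (posRpow p) :=
  Measurable.ite measurableSet_Ioi (by fun_prop) measurable_const

lemma posRpow_ne_top (p x : ℝ) : posRpow p x ≠ ∞ := by
  unfold posRpow; split_ifs <;> simp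

lemma posRpow_mul_left {p c : ℝ} (hc : 0 < c) (x : ℝ) :
    posRpow p (c * x) = posRpow p c * posRpow p x := by
  rcases le_or_gt x 0 with hx | hx
  · rw [posRpow_of_nonpos hx, posRpow_of_nonpos (mul_nonpos_of_nonneg_of_nonpos hc.le hx), mul_zero]
  · rw [posRpow_of_pos hx, posRpow_of_pos hc, posRpow_of_pos (mul_pos hc hx),
      Real.mul_rpow hc.le hx.le, ENNReal.ofReal_mul (by positivity)]

lemma posRpow_mul_posRpow (p q x : ℝ) : posRpow p x * posRpow q x = posRpow (p + q) x := by
  rcases le_or_gt x 0 with hx | hx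
  · simp [posRpow_of_nonpos hx]
  · rw [posRpow_of_pos hx, posRpow_of_pos hx, posRpow_of_pos hx, Real.rpow_add hx,
      ENNReal.ofReal_mul (by positivity)]

lemma posRpow_one_of_pos {x : ℝ} (hx : 0 < x) : posRpow 1 x = ENNReal.ofReal x := by
  rw [posRpow_of_pos hx, Real.rpow_one]

lemma posRpow_zero_of_pos {x : ℝ} (hx : 0 < x) : posRpow 0 x = 1 := by
  rw [posRpow_of_pos hx, Real.rpow_zero, ENNReal.ofReal_one]

lemma posRpow_sq {q x : ℝ} (hx : 0 < x) : posRpow q (x ^ 2) = posRpow (2 * q) x := by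
  rw [posRpow_of_pos hx, posRpow_of_pos (by positivity), ← Real.rpow_natCast, ← Real.rpow_mul hx.le]
  norm_num

lemma lintegral_comp_pos_smul {E : Type*} [NormedAddCommGroup E] [NormedSpace ℝ E]
    [MeasurableSpace E] [BorelSpace E] [FiniteDimensional ℝ E] (μ : Measure E)
    [μ.IsAddHaarMeasure] {s : ℝ} (hs : 0 < s) (f : E → ℝ≥0∞) :
    ∫⁻ x, f x ∂μ = ENNReal.ofReal (s ^ Module.finrank ℝ E) * ∫⁻ x, f (s • x) ∂μ := by
  have h : ∫⁻ x, f (s • x) ∂μ = ∫⁻ x, f x ∂(μ.map (fun x => s • x)) :=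
    ((Homeomorph.smulOfNeZero s hs.ne').measurableEmbedding.lintegral_map f).symm
  rw [h, Measure.map_addHaar_smul μ hs.ne', lintegral_smul_measure, smul_eq_mul, ← mul_assoc,
    ← ENNReal.ofReal_mul (by positivity), abs_of_pos (by positivity),
    mul_inv_cancel₀ (by positivity), ENNReal.ofReal_one, one_mul]

lemma lintegral_posRpow_mul_posRpow_one_sub {x y : ℝ} (hx : 0 < x) (hy : 0 < y) :
    ∫⁻ r, posRpow (x - 1) r * posRpow (y - 1) (1 - r) =
      ENNReal.ofReal (ProbabilityTheory.beta x y) := by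
  have hb := ProbabilityTheory.beta_pos hx hy
  have h : ∀ r, posRpow (x - 1) r * posRpow (y - 1) (1 - r) =
      ENNReal.ofReal (ProbabilityTheory.beta x y) * ProbabilityTheory.betaPDF x y r := by
    intro r
    rcases le_or_gt r 0 with h0 | h0
    · rw [posRpow_of_nonpos h0, ProbabilityTheory.betaPDF_eq_zero_of_nonpos h0]; simp
    rcases le_or_gt 1 r with h1 | h1
    · rw [posRpow_of_nonpos (by linarith : 1 - r ≤ 0),
        ProbabilityTheory.betaPDF_eq_zero_of_one_le h1]; simp
    · rw [ProbabilityTheory.betaPDF_of_pos_lt_one h0 h1, posRpow_of_pos h0,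
        posRpow_of_pos (by linarith), ← ENNReal.ofReal_mul hb.le,
        ← ENNReal.ofReal_mul (by positivity)]
      congr 1
      field_simp
  simp_rw [h]
  rw [lintegral_const_mul' _ _ ENNReal.ofReal_ne_top,
    ProbabilityTheory.lintegral_betaPDF_eq_one hx hy, mul_one]

/-- Scaling by `L` reduces this to the unit interval; for `L ≤ 0` the two supports are disjoint. -/
lemma lintegral_posRpow_mul_posRpow_sub {x y : ℝ} (hx : 0 < x) (hy : 0 < y) (L : ℝ) :
    ∫⁻ r, posRpow (x - 1) r * posRpow (y - 1) (L - r) =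
      posRpow (x + y - 1) L * ENNReal.ofReal (ProbabilityTheory.beta x y) := by
  rcases le_or_gt L 0 with hL | hL
  · rw [posRpow_of_nonpos hL, zero_mul]
    refine lintegral_eq_zero_of_ae_eq_zero (Filter.Eventually.of_forall fun r => ?_)
    rcases le_or_gt r 0 with h0 | h0
    · simp [posRpow_of_nonpos h0]
    · simp [posRpow_of_nonpos (by linarith : L - r ≤ 0)]
  · have h : ∀ r : ℝ, posRpow (x - 1) (L • r) * posRpow (y - 1) (L - L • r) =
        posRpow (x - 1 + (y - 1)) L * (posRpow (x - 1) r * posRpow (y - 1) (1 - r)) := by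
      intro r
      rw [smul_eq_mul, show L - L * r = L * (1 - r) by ring, posRpow_mul_left hL,
        posRpow_mul_left hL, ← posRpow_mul_posRpow]
      ring
    rw [lintegral_comp_pos_smul volume hL]
    simp_rw [h]
    rw [lintegral_const_mul' _ _ (posRpow_ne_top _ _), lintegral_posRpow_mul_posRpow_one_sub hx hy,
      ← mul_assoc, Module.finrank_self, pow_one, ← posRpow_one_of_pos hL, posRpow_mul_posRpow]
    congr 2
    ring

/-! ### Integrals over the unit disc in polar coordinates. -/

lemma lintegral_complex_polar {f : ℂ → ℝ≥0∞} (hf : Measurable f) :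
    ∫⁻ a, f a = ∫⁻ θ in Ioo (-Real.pi) Real.pi, ∫⁻ r in Ioi (0 : ℝ),
      ENNReal.ofReal r * f (r * (Real.cos θ + Real.sin θ * Complex.I)) := by
  rw [← Complex.lintegral_comp_polarCoord_symm, polarCoord_target, Measure.volume_eq_prod,
    ← Measure.prod_restrict, lintegral_prod_symm]
  · simp [smul_eq_mul]
  · simp only [Complex.polarCoord_symm_apply, smul_eq_mul]
    fun_prop

lemma norm_polar {r : ℝ} (hr : 0 < r) (θ : ℝ) :
    ‖(r : ℂ) * (Real.cos θ + Real.sin θ * Complex.I)‖ = r := by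
  rw [norm_mul, Complex.norm_real, Real.norm_of_nonneg hr.le, Complex.ofReal_cos,
    Complex.ofReal_sin, Complex.norm_cos_add_sin_mul_I, mul_one]

lemma setLIntegral_Ioi_eq_of_posRpow (p : ℝ) (f : ℝ → ℝ≥0∞) :
    ∫⁻ r in Ioi (0 : ℝ), posRpow p r * f r = ∫⁻ r, posRpow p r * f r := by
  rw [← lintegral_indicator measurableSet_Ioi]
  refine lintegral_congr fun r => ?_
  by_cases hr : 0 < r
  · simp [hr]
  · simp [hr, posRpow_of_nonpos (not_lt.1 hr)]

lemma lintegral_posRpow_mul_posRpow_one_sub_sq {q p : ℝ} (hq : -2 < q) (hp : -1 < p) :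
    2 * ∫⁻ r, posRpow (q + 1) r * posRpow p (1 - r ^ 2) =
      ENNReal.ofReal (ProbabilityTheory.beta (q / 2 + 1) (p + 1)) := by
  rw [← lintegral_posRpow_mul_posRpow_one_sub (by linarith) (by linarith),
    ← setLIntegral_Ioi_eq_of_posRpow, ← setLIntegral_Ioi_eq_of_posRpow]
  have himg : (fun x : ℝ => x ^ 2) '' Ioi 0 = Ioi 0 := by
    ext y
    constructor
    · rintro ⟨x, hx, rfl⟩
      exact pow_pos (mem_Ioi.1 hx) 2
    · intro hy
      exact ⟨Real.sqrt y, Real.sqrt_pos.2 hy, Real.sq_sqrt (le_of_lt hy)⟩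
  have := lintegral_image_eq_lintegral_abs_deriv_mul (s := Ioi (0 : ℝ)) measurableSet_Ioi
    (f := fun x : ℝ => x ^ 2) (f' := fun x => 2 * x)
    (fun x _ => by simpa using (hasDerivAt_pow 2 x).hasDerivWithinAt)
    (fun x hx y hy h => by
      exact (pow_left_inj₀ (le_of_lt hx) (le_of_lt hy) two_ne_zero).1 h)
    (fun r => posRpow (q / 2 + 1 - 1) r * posRpow (p + 1 - 1) (1 - r))
  rw [himg] at this
  rw [this, ← lintegral_const_mul' _ _ (by simp)]
  refine setLIntegral_congr_fun measurableSet_Ioi fun r hr => ?_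
  have hr : 0 < r := hr
  rw [posRpow_sq hr, abs_of_pos (by positivity), ENNReal.ofReal_mul zero_le_two,
    ← posRpow_one_of_pos hr, show 2 * (q / 2 + 1 - 1) = q by ring, add_sub_cancel_right,
    add_comm q 1, ← posRpow_mul_posRpow]
  simp only [ENNReal.ofReal_ofNat]
  ring

lemma lintegral_complex_norm_posRpow {q p : ℝ} (hq : -2 < q) (hp : -1 < p) :
    ∫⁻ a : ℂ, posRpow q ‖a‖ * posRpow p (1 - ‖a‖ ^ 2) =
      ENNReal.ofReal (Real.pi * ProbabilityTheory.beta (q / 2 + 1) (p + 1)) := by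
  rw [lintegral_complex_polar (by fun_prop)]
  have h : ∀ θ : ℝ, ∫⁻ r in Ioi (0 : ℝ), ENNReal.ofReal r *
      (posRpow q ‖(r : ℂ) * (Real.cos θ + Real.sin θ * Complex.I)‖ *
        posRpow p (1 - ‖(r : ℂ) * (Real.cos θ + Real.sin θ * Complex.I)‖ ^ 2)) =
      ∫⁻ r, posRpow (q + 1) r * posRpow p (1 - r ^ 2) := by
    intro θ
    rw [← setLIntegral_Ioi_eq_of_posRpow]
    refine setLIntegral_congr_fun measurableSet_Ioi fun r hr => ?_
    rw [norm_polar hr, ← posRpow_one_of_pos hr, ← mul_assoc, posRpow_mul_posRpow, add_comm]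
  simp_rw [h]
  rw [setLIntegral_const, Real.volume_Ioo, mul_comm, show Real.pi - -Real.pi = Real.pi * 2 by ring,
    ENNReal.ofReal_mul Real.pi_pos.le, ENNReal.ofReal_mul Real.pi_pos.le,
    ← lintegral_posRpow_mul_posRpow_one_sub_sq hq hp, ENNReal.ofReal_ofNat, mul_assoc]

lemma beta_one_left {y : ℝ} (hy : 0 < y) : ProbabilityTheory.beta 1 y = 1 / y := by
  have := (Real.Gamma_pos_of_pos hy).ne'
  rw [ProbabilityTheory.beta, Real.Gamma_one, one_mul, add_comm, Real.Gamma_add_one hy.ne']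
  field_simp

/-- The integral of `(1 - |a|²)ᵖ` over the unit disc. -/
lemma lintegral_complex_posRpow {p : ℝ} (hp : -1 < p) :
    ∫⁻ a : ℂ, posRpow p (1 - ‖a‖ ^ 2) = ENNReal.ofReal (Real.pi / (p + 1)) := by
  have := lintegral_complex_norm_posRpow (q := 0) (by norm_num) hp
  rw [zero_div, zero_add, beta_one_left (by linarith), mul_one_div] at this
  rw [← this]
  refine lintegral_congr_ae ?_
  -- The origin is discarded because `posRpow 0 0` is 0, not 1.
  have h0 : ∀ᵐ a : ℂ, a ≠ 0 := by simp [ae_iff]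
  filter_upwards [h0] with a ha
  rw [posRpow_zero_of_pos (norm_pos_iff.2 ha), one_mul]

/-- The integral of `(2 cos θ)ᵐ` over the half circle where the cosine is positive. -/
def cosIntegral (m : ℝ) : ℝ≥0∞ :=
  ∫⁻ θ in Ioo (-Real.pi) Real.pi, posRpow m (2 * Real.cos θ)

/-- In polar coordinates at the boundary point 1, `a = 1 - r e^{iθ}` gives `1 - |a|² = r (2 cos θ -
r)`, so the radial integral is a Beta integral over an interval of length `2 cos θ`. -/
lemma lintegral_complex_one_sub_posRpow {q p : ℝ} (hqp : 0 < 2 - q + p) (hp : -1 < p) :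
    ∫⁻ a : ℂ, posRpow (-q) ‖1 - a‖ * posRpow p (1 - ‖a‖ ^ 2) =
      ENNReal.ofReal (ProbabilityTheory.beta (2 - q + p) (p + 1)) *
        cosIntegral (2 - q + 2 * p) := by
  rw [← lintegral_sub_left_eq_self _ (1 : ℂ), lintegral_complex_polar (by fun_prop)]
  have h : ∀ θ : ℝ, ∫⁻ r in Ioi (0 : ℝ), ENNReal.ofReal r *
      (posRpow (-q) ‖1 - (1 - (r : ℂ) * (Real.cos θ + Real.sin θ * Complex.I))‖ *
        posRpow p (1 - ‖1 - (r : ℂ) * (Real.cos θ + Real.sin θ * Complex.I)‖ ^ 2)) =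
      ENNReal.ofReal (ProbabilityTheory.beta (2 - q + p) (p + 1)) *
        posRpow (2 - q + 2 * p) (2 * Real.cos θ) := by
    intro θ
    have := lintegral_posRpow_mul_posRpow_sub hqp (by linarith : 0 < p + 1) (2 * Real.cos θ)
    rw [show 2 - q + p + (p + 1) - 1 = 2 - q + 2 * p by ring, mul_comm (posRpow _ _)] at this
    rw [← this, ← setLIntegral_Ioi_eq_of_posRpow]
    refine setLIntegral_congr_fun measurableSet_Ioi fun r hr => ?_
    have hr : 0 < r := hr
    have hn : 1 - ‖1 - (r : ℂ) * (Real.cos θ + Real.sin θ * Complex.I)‖ ^ 2 =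
        r * (2 * Real.cos θ - r) := by
      rw [← Complex.normSq_eq_norm_sq, Complex.normSq_apply]
      simp only [Complex.sub_re, Complex.sub_im, Complex.mul_re, Complex.mul_im, Complex.one_re,
        Complex.one_im, Complex.ofReal_re, Complex.ofReal_im, Complex.add_re, Complex.add_im,
        Complex.I_re, Complex.I_im]
      linear_combination (-r ^ 2) * Real.sin_sq_add_cos_sq θ
    rw [sub_sub_cancel, norm_polar hr, hn, ← posRpow_one_of_pos hr, posRpow_mul_left hr,
      ← mul_assoc, ← mul_assoc, posRpow_mul_posRpow, posRpow_mul_posRpow,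
      add_sub_cancel_right, show 1 + -q + p = 2 - q + p - 1 by ring]
  simp_rw [h]
  rw [lintegral_const_mul' _ _ ENNReal.ofReal_ne_top, cosIntegral]

/-- The integral of `(1 - |a|²)^(m/2 - 1)` over the disc is computed in polar coordinates about 0
and about 1. The second computation contains `cosIntegral m`, and comparing the two determines it.
-/
lemma cosIntegral_eq {m : ℝ} (hm : 0 < m) :
    cosIntegral m =
      ENNReal.ofReal (Real.pi * Real.Gamma (m + 1) / Real.Gamma (m / 2 + 1) ^ 2) := by
  have h1 := lintegral_complex_one_sub_posRpow (q := 0) (p := m / 2 - 1) (by linarith)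
    (by linarith)
  have h2 : ∫⁻ a : ℂ, posRpow (-0) ‖1 - a‖ * posRpow (m / 2 - 1) (1 - ‖a‖ ^ 2) =
      ENNReal.ofReal (Real.pi / (m / 2 - 1 + 1)) := by
    rw [← lintegral_complex_posRpow (by linarith)]
    refine lintegral_congr fun a => ?_
    by_cases ha : a = 1
    · rw [ha]; simp [posRpow_of_nonpos]
    · rw [neg_zero, posRpow_zero_of_pos (norm_pos_iff.2 (sub_ne_zero.2 (Ne.symm ha))), one_mul]
  rw [h2, show 2 - 0 + 2 * (m / 2 - 1) = m by ring, show 2 - 0 + (m / 2 - 1) = m / 2 + 1 by ring,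
    sub_add_cancel] at h1
  have hG := Real.Gamma_pos_of_pos (by linarith : 0 < m / 2)
  have hG1 := Real.Gamma_pos_of_pos (by linarith : 0 < m / 2 + 1)
  have hG2 := Real.Gamma_pos_of_pos (by linarith : 0 < m + 1)
  have hb := ProbabilityTheory.beta_pos (by linarith : 0 < m / 2 + 1) (by linarith : 0 < m / 2)
  have : cosIntegral m = ENNReal.ofReal (Real.pi / (m / 2)) /
      ENNReal.ofReal (ProbabilityTheory.beta (m / 2 + 1) (m / 2)) := by
    rw [h1, mul_comm, ENNReal.mul_div_cancel_right (by simpa using hb) ENNReal.ofReal_ne_top]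
  rw [this, ← ENNReal.ofReal_div_of_pos hb, ProbabilityTheory.beta,
    show m / 2 + 1 + m / 2 = m + 1 by ring, Real.Gamma_add_one (by linarith : m / 2 ≠ 0)]
  congr 1
  field_simp

/-! ### Splitting off the first coordinate of `ℂᵏ⁺¹`. -/

/-- Prepend a coordinate to a vector of `ℂᵏ`. -/
def consCn {k : ℕ} (a : ℂ) (u : Cn k) : Cn (k + 1) := WithLp.toLp 2 (Fin.cons a u.ofLp)

/-- Drop the first coordinate of a vector of `ℂᵏ⁺¹`. -/
def tailCn {k : ℕ} (w : Cn (k + 1)) : Cn k := WithLp.toLp 2 (Fin.tail w.ofLp)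

@[simp] lemma consCn_zero {k : ℕ} (a : ℂ) (u : Cn k) : consCn a u 0 = a := rfl

@[simp] lemma tailCn_consCn {k : ℕ} (a : ℂ) (u : Cn k) : tailCn (consCn a u) = u := rfl

@[simp] lemma tailCn_apply {k : ℕ} (w : Cn (k + 1)) (i : Fin k) : tailCn w i = w i.succ := rfl

lemma norm_consCn_sq {k : ℕ} (a : ℂ) (u : Cn k) : ‖consCn a u‖ ^ 2 = ‖a‖ ^ 2 + ‖u‖ ^ 2 := by
  rw [EuclideanSpace.norm_sq_eq, EuclideanSpace.norm_sq_eq, Fin.sum_univ_succ]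
  rfl

/-- The splitting `ℂᵏ⁺¹ = ℂ × ℂᵏ` as an isometry. -/
def consIsometry (k : ℕ) : WithLp 2 (ℂ × Cn k) ≃ₗᵢ[ℝ] Cn (k + 1) where
  toFun p := consCn p.fst p.snd
  invFun w := WithLp.toLp 2 (w 0, tailCn w)
  map_add' p q := by
    ext i
    refine Fin.cases ?_ (fun j => ?_) i <;> simp [consCn]
  map_smul' c p := by
    ext i
    refine Fin.cases ?_ (fun j => ?_) i <;> simp [consCn]
  left_inv p := rfl
  right_inv w := by
    ext i
    refine Fin.cases ?_ (fun j => ?_) i <;> rfl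
  norm_map' p := by
    refine (pow_left_inj₀ (norm_nonneg _) (norm_nonneg _) two_ne_zero).1 ?_
    rw [WithLp.prod_norm_sq_eq_of_L2, ← norm_consCn_sq]
    rfl

lemma measurable_tailCn {k : ℕ} : Measurable (tailCn : Cn (k + 1) → Cn k) := by
  unfold tailCn Fin.tail
  fun_prop

lemma measurable_coord {k : ℕ} (i : Fin k) : Measurable (fun w : Cn k => w i) := by
  fun_prop

lemma lintegral_consCn {k : ℕ} {f : Cn (k + 1) → ℝ≥0∞} (hf : Measurable f) :
    ∫⁻ w, f w = ∫⁻ a : ℂ, ∫⁻ u : Cn k, f (consCn a u) := by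
  have h := (consIsometry k).measurePreserving
  have h2 := WithLp.volume_preserving_toLp ℂ (Cn k)
  have h3 := hf.comp h.measurable
  have h4 : Measurable fun p : ℂ × Cn k => f (consIsometry k (WithLp.toLp 2 p)) :=
    h3.comp h2.measurable
  rw [← h.lintegral_comp hf, ← h2.lintegral_comp (f := fun p => f (consIsometry k p)) h3,
    Measure.volume_eq_prod, lintegral_prod _ h4.aemeasurable]
  rfl

lemma finrank_real_Cn (k : ℕ) : Module.finrank ℝ (Cn k) = 2 * k := by
  rw [finrank_real_of_complex, finrank_euclideanSpace_fin]

/-- On the slice `w 0 = a` the remaining coordinates fill a ball of radius `s = √(1 - |a|²)`.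
Rescaling it to the unit ball produces `s^(2k)` from the volume, `s^j` from the homogeneity of `φ`
and `s^(2α)` from the weight. -/
lemma lintegral_marginal {k : ℕ} {α j : ℝ} {h : ℂ → ℝ≥0∞} (hh : Measurable h)
    {φ : Cn k → ℝ≥0∞} (hφ : Measurable φ)
    (hj : ∀ s : ℝ, 0 < s → ∀ u, φ (s • u) = posRpow j s * φ u) :
    ∫⁻ w : Cn (k + 1), h (w 0) * φ (tailCn w) * posRpow α (1 - ‖w‖ ^ 2) =
      (∫⁻ u : Cn k, φ u * posRpow α (1 - ‖u‖ ^ 2)) *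
        ∫⁻ a : ℂ, h a * posRpow (α + k + j / 2) (1 - ‖a‖ ^ 2) := by
  have hm : Measurable fun w : Cn (k + 1) =>
      h (w 0) * φ (tailCn w) * posRpow α (1 - ‖w‖ ^ 2) :=
    ((hh.comp (measurable_coord 0)).mul (hφ.comp measurable_tailCn)).mul (by fun_prop)
  rw [lintegral_consCn hm, ← lintegral_const_mul _ (by fun_prop)]
  refine lintegral_congr fun a => ?_
  simp only [consCn_zero, tailCn_consCn, norm_consCn_sq]
  rcases le_or_gt (1 - ‖a‖ ^ 2) 0 with ha | ha
  · rw [posRpow_of_nonpos ha]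
    have : ∀ u : Cn k, posRpow α (1 - (‖a‖ ^ 2 + ‖u‖ ^ 2)) = 0 := fun u =>
      posRpow_of_nonpos (by nlinarith [sq_nonneg ‖u‖])
    simp [this]
  · obtain ⟨s, hs, hs2⟩ : ∃ s : ℝ, 0 < s ∧ s ^ 2 = 1 - ‖a‖ ^ 2 :=
      ⟨_, Real.sqrt_pos.2 ha, Real.sq_sqrt ha.le⟩
    rw [lintegral_comp_pos_smul volume hs, finrank_real_Cn, ← hs2]
    have : ∀ u : Cn k, h a * φ (s • u) * posRpow α (1 - (‖a‖ ^ 2 + ‖s • u‖ ^ 2)) =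
        h a * posRpow j s * posRpow α (s ^ 2) * (φ u * posRpow α (1 - ‖u‖ ^ 2)) := by
      intro u
      rw [hj s hs, norm_smul, Real.norm_of_nonneg hs.le,
        show 1 - (‖a‖ ^ 2 + (s * ‖u‖) ^ 2) = s ^ 2 * (1 - ‖u‖ ^ 2) by
          linear_combination (-1) * hs2, posRpow_mul_left (pow_pos hs 2)]
      ring
    simp_rw [this]
    rw [lintegral_const_mul _ (by fun_prop)]
    have hp : ENNReal.ofReal (s ^ (2 * k)) = posRpow (2 * k) s := by
      rw [posRpow_of_pos hs, ← Real.rpow_natCast]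
      norm_num
    rw [hp, posRpow_sq hs, posRpow_sq hs,
      show 2 * (α + k + j / 2) = 2 * k + j + 2 * α by ring, ← posRpow_mul_posRpow,
      ← posRpow_mul_posRpow]
    ring

/-- The integral of `(1 - |w|²)^α` over the unit ball of `ℂᵏ`. -/
def ballIntegral (k : ℕ) (α : ℝ) : ℝ≥0∞ := ∫⁻ u : Cn k, posRpow α (1 - ‖u‖ ^ 2)

lemma lintegral_marginal_one {k : ℕ} {α : ℝ} {h : ℂ → ℝ≥0∞} (hh : Measurable h) :
    ∫⁻ w : Cn (k + 1), h (w 0) * posRpow α (1 - ‖w‖ ^ 2) =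
      ballIntegral k α * ∫⁻ a : ℂ, h a * posRpow (α + k) (1 - ‖a‖ ^ 2) := by
  have := lintegral_marginal (k := k) (α := α) (j := 0) hh (φ := fun _ => 1) measurable_const
    (fun s hs u => by rw [posRpow_zero_of_pos hs, one_mul])
  simpa [ballIntegral] using this

lemma ballIntegral_succ {k : ℕ} {α : ℝ} (hα : -1 < α) :
    ballIntegral (k + 1) α = ballIntegral k α * ENNReal.ofReal (Real.pi / (α + k + 1)) := by
  have := lintegral_marginal_one (k := k) (α := α) (h := fun _ => 1) measurable_const
  simp only [one_mul] at this
  rw [ballIntegral, this, lintegral_complex_posRpow]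
  have : (0 : ℝ) ≤ k := k.cast_nonneg
  linarith

lemma ballIntegral_ne_zero_ne_top {α : ℝ} (hα : -1 < α) (k : ℕ) :
    ballIntegral k α ≠ 0 ∧ ballIntegral k α ≠ ∞ := by
  induction k with
  | zero =>
    -- `ℂ⁰` is a point, where the weight is 1; only the positivity and finiteness of its mass
    -- matter.
    have h : ∀ u : Cn 0, posRpow α (1 - ‖u‖ ^ 2) = 1 := fun u => by
      rw [Subsingleton.elim u 0]
      simp [posRpow]
    have hv : IsFiniteMeasure (volume : Measure (Cn 0)) := by
      refine ⟨?_⟩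
      rw [(Set.subsingleton_of_subsingleton (s := (univ : Set (Cn 0)))).eq_singleton_of_mem
        (mem_univ 0)]
      exact isCompact_singleton.measure_lt_top
    simp only [ballIntegral, h, lintegral_one]
    exact ⟨(isOpen_univ.measure_pos volume univ_nonempty).ne', measure_ne_top _ _⟩
  | succ k ih =>
    rw [ballIntegral_succ hα]
    have hk : (0 : ℝ) ≤ k := k.cast_nonneg
    have : 0 < Real.pi / (α + k + 1) := div_pos Real.pi_pos (by linarith)
    exact ⟨mul_ne_zero ih.1 (by simpa using this), ENNReal.mul_ne_top ih.2 ENNReal.ofReal_ne_top⟩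

/-! ### The weighted probability measure and its unitary invariance. -/

lemma mem_unitBall {n : ℕ} {w : Cn n} : w ∈ unitBall n ↔ ‖w‖ < 1 := mem_ball_zero_iff

lemma measurableSet_unitBall (n : ℕ) : MeasurableSet (unitBall n) :=
  Metric.isOpen_ball.measurableSet

lemma setLIntegral_unitBall {n : ℕ} {α : ℝ} (f : Cn n → ℝ≥0∞) :
    ∫⁻ w in unitBall n, ENNReal.ofReal ((1 - ‖w‖ ^ 2) ^ α) * f w =
      ∫⁻ w, f w * posRpow α (1 - ‖w‖ ^ 2) := by
  rw [← lintegral_indicator (measurableSet_unitBall n)]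
  refine lintegral_congr fun w => ?_
  by_cases hw : w ∈ unitBall n
  · have : 0 < 1 - ‖w‖ ^ 2 := by
      have := mem_unitBall.1 hw
      nlinarith [norm_nonneg w]
    rw [indicator_of_mem hw, posRpow_of_pos this, mul_comm]
  · have : 1 - ‖w‖ ^ 2 ≤ 0 := by
      have := mem_unitBall.not.1 hw
      nlinarith [norm_nonneg w]
    rw [indicator_of_notMem hw, posRpow_of_nonpos this, mul_zero]

lemma volume_unitBall_ne_zero (n : ℕ) : volume (unitBall n) ≠ 0 :=
  (Metric.measure_ball_pos volume 0 one_pos).ne'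

lemma volume_unitBall_ne_top (n : ℕ) : volume (unitBall n) ≠ ∞ := measure_ball_lt_top.ne

lemma lintegral_ballMeasure {n : ℕ} (f : Cn n → ℝ≥0∞) :
    ∫⁻ w, f w ∂(ballMeasure n) = (volume (unitBall n))⁻¹ * ∫⁻ w in unitBall n, f w := by
  rw [ballMeasure, lintegral_smul_measure, smul_eq_mul]

lemma ae_ballMeasure_mem (n : ℕ) : ∀ᵐ w ∂(ballMeasure n), w ∈ unitBall n := by
  exact Measure.ae_smul_measure (ae_restrict_mem (measurableSet_unitBall n)) _

lemma ofReal_weightConst {n : ℕ} {α : ℝ} (hα : -1 < α) :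
    0 < weightConst n α ∧ ENNReal.ofReal (weightConst n α) =
      volume (unitBall n) * (ballIntegral n α)⁻¹ := by
  have hI := ballIntegral_ne_zero_ne_top hα n
  have hnn : 0 ≤ᵐ[ballMeasure n] fun z : Cn n => (1 - ‖z‖ ^ 2) ^ α := by
    filter_upwards [ae_ballMeasure_mem n] with w hw
    have := mem_unitBall.1 hw
    exact Real.rpow_nonneg (by nlinarith [norm_nonneg w]) _
  have h1 := setLIntegral_unitBall (n := n) (α := α) (fun _ => 1)
  simp only [mul_one, one_mul] at h1
  have h : weightConst n α = ((volume (unitBall n))⁻¹ * ballIntegral n α)⁻¹.toReal := by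
    rw [weightConst, integral_eq_lintegral_of_nonneg_ae hnn
      (by exact Measurable.aestronglyMeasurable (by fun_prop)), lintegral_ballMeasure,
      ENNReal.toReal_inv, h1]
    rfl
  have hv0 := volume_unitBall_ne_zero n
  have hv1 := volume_unitBall_ne_top n
  have e : ((volume (unitBall n))⁻¹ * ballIntegral n α)⁻¹ =
      volume (unitBall n) * (ballIntegral n α)⁻¹ := by
    rw [ENNReal.mul_inv (Or.inl (ENNReal.inv_ne_zero.2 hv1))
      (Or.inl (ENNReal.inv_ne_top.2 hv0)), inv_inv]
  have hT : volume (unitBall n) * (ballIntegral n α)⁻¹ ≠ ∞ :=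
    ENNReal.mul_ne_top hv1 (ENNReal.inv_ne_top.2 hI.1)
  rw [h, e]
  exact ⟨ENNReal.toReal_pos (mul_ne_zero hv0 (ENNReal.inv_ne_zero.2 hI.2)) hT,
    ENNReal.ofReal_toReal hT⟩

/-- The volume of the ball enters `ballMeasure` and `weightConst` inversely and cancels. The
truncation in `posRpow` replaces the restriction to the ball. -/
lemma lintegral_weightedMeasure {n : ℕ} {α : ℝ} (hα : -1 < α) (f : Cn n → ℝ≥0∞) :
    ∫⁻ w, f w ∂(weightedMeasure n α) =
      (ballIntegral n α)⁻¹ * ∫⁻ w, f w * posRpow α (1 - ‖w‖ ^ 2) := by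
  obtain ⟨hc, hc'⟩ := ofReal_weightConst (n := n) hα
  have hm : Measurable fun z : Cn n =>
      ENNReal.ofReal (weightConst n α * (1 - ‖z‖ ^ 2) ^ α) := by fun_prop
  rw [weightedMeasure, lintegral_withDensity_eq_lintegral_mul_non_measurable₀ _ hm.aemeasurable
    (Filter.Eventually.of_forall fun _ => ENNReal.ofReal_lt_top), lintegral_ballMeasure]
  simp only [Pi.mul_apply, ENNReal.ofReal_mul hc.le, mul_assoc]
  rw [lintegral_const_mul' _ _ ENNReal.ofReal_ne_top, setLIntegral_unitBall, hc', ← mul_assoc,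
    ← mul_assoc, ENNReal.inv_mul_cancel (volume_unitBall_ne_zero n) (volume_unitBall_ne_top n),
    one_mul]

lemma isProbabilityMeasure_weightedMeasure {n : ℕ} {α : ℝ} (hα : -1 < α) :
    IsProbabilityMeasure (weightedMeasure n α) := by
  have hI := ballIntegral_ne_zero_ne_top hα n
  refine ⟨?_⟩
  have := lintegral_weightedMeasure (n := n) hα (fun _ => 1)
  simp only [lintegral_one, one_mul] at this
  rw [this]
  exact ENNReal.inv_mul_cancel hI.1 hI.2

lemma weightedMeasure_absolutelyContinuous (n : ℕ) (α : ℝ) :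
    weightedMeasure n α ≪ ballMeasure n := withDensity_absolutelyContinuous _ _

lemma ae_weightedMeasure_mem (n : ℕ) (α : ℝ) : ∀ᵐ w ∂(weightedMeasure n α), w ∈ unitBall n :=
  (weightedMeasure_absolutelyContinuous n α).ae_le (ae_ballMeasure_mem n)

lemma measurePreserving_weightedMeasure {n : ℕ} {α : ℝ} (hα : -1 < α) (U : Cn n ≃ₗᵢ[ℂ] Cn n) :
    MeasurePreserving U (weightedMeasure n α) (weightedMeasure n α) := by
  let U' : Cn n ≃ₗᵢ[ℝ] Cn n := ⟨U.toLinearEquiv.restrictScalars ℝ, U.norm_map⟩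
  have h : MeasurePreserving U (volume : Measure (Cn n)) volume := U'.measurePreserving
  refine ⟨h.measurable, ?_⟩
  ext s hs
  have h1 := lintegral_weightedMeasure (n := n) hα (s.indicator 1)
  have h2 := lintegral_weightedMeasure (n := n) hα ((U ⁻¹' s).indicator 1)
  rw [lintegral_indicator_one hs] at h1
  rw [lintegral_indicator_one (h.measurable hs)] at h2
  rw [Measure.map_apply h.measurable hs, h1, h2,
    ← h.lintegral_comp (f := fun w => s.indicator 1 w * posRpow α (1 - ‖w‖ ^ 2))
      ((measurable_one.indicator hs).mul (by fun_prop))]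
  simp only [U.norm_map]
  rfl

/-! ### The integrals behind the values of `ell` at 0 and `π/2`. -/

lemma inv_mul_mul_cancel_left {b d x : ℝ≥0∞} (hb : b ≠ 0) (hb' : b ≠ ∞) :
    (b * d)⁻¹ * (b * x) = d⁻¹ * x := by
  rw [ENNReal.mul_inv (Or.inl hb) (Or.inl hb'), mul_assoc, mul_left_comm d⁻¹, ← mul_assoc,
    ENNReal.inv_mul_cancel hb hb', one_mul]

lemma norm_coord_le {n : ℕ} (w : Cn n) (i : Fin n) : ‖w i‖ ≤ ‖w‖ := PiLp.norm_apply_le w i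

/-- With `m = k + 1 + α` the exponent is one less than that of the kernel: this is the case `t = 0`,
where the numerator `|1 - w 0|` cancels one power. The marginal weight `(1 - |a|²)^(m-1)` then leads
to `cosIntegral m`. -/
lemma lintegral_one_sub_coord {k : ℕ} {α : ℝ} (hα : -1 < α) (hm : 0 < k + 1 + α) :
    ∫⁻ w : Cn (k + 1), posRpow (-(k + 1 + α)) ‖1 - w 0‖ ∂(weightedMeasure (k + 1) α) =
      ENNReal.ofReal
        (Real.Gamma (k + 1 + α + 1) / Real.Gamma ((k + 1 + α) / 2 + 1) ^ 2) := by
  set m : ℝ := k + 1 + α with hm_def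
  have hk : (0 : ℝ) ≤ k := k.cast_nonneg
  obtain ⟨hb, hb'⟩ := ballIntegral_ne_zero_ne_top hα k
  have h := lintegral_marginal_one (k := k) (α := α) (h := fun a => posRpow (-m) ‖1 - a‖)
    (by fun_prop)
  have h2 := lintegral_complex_one_sub_posRpow (q := m) (p := m - 1) (by linarith) (by linarith)
  rw [show α + (k : ℝ) = m - 1 by rw [hm_def]; ring, h2, show 2 - m + (m - 1) = 1 by ring,
    show 2 - m + 2 * (m - 1) = m by ring, sub_add_cancel, beta_one_left hm,
    cosIntegral_eq hm, ← ENNReal.ofReal_mul (by positivity)] at h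
  rw [lintegral_weightedMeasure hα, h, ballIntegral_succ hα, inv_mul_mul_cancel_left hb hb',
    show α + k + 1 = m by rw [hm_def]; ring, ← ENNReal.ofReal_inv_of_pos (by positivity),
    ← ENNReal.ofReal_mul (by positivity)]
  congr 1
  have := Real.Gamma_pos_of_pos (by linarith : 0 < m / 2 + 1)
  field_simp

lemma lintegral_coord_eq {n : ℕ} {α : ℝ} (hα : -1 < α) (i j : Fin n) :
    ∫⁻ w : Cn n, ‖w i‖ₑ ∂(weightedMeasure n α) = ∫⁻ w : Cn n, ‖w j‖ₑ ∂(weightedMeasure n α) := by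
  have h := measurePreserving_weightedMeasure hα
    (LinearIsometryEquiv.piLpCongrLeft 2 ℂ ℂ (Equiv.swap i j))
  rw [← h.lintegral_comp (f := fun w => ‖w i‖ₑ) (by fun_prop)]
  simp [Equiv.piCongrLeft', LinearIsometryEquiv.piLpCongrLeft_apply]

lemma beta_mul_beta {m : ℝ} (hm : 0 < m) :
    m * (m + 1 / 2) * ProbabilityTheory.beta (3 / 2) m * ProbabilityTheory.beta (1 / 2) (m + 1 / 2)
      = Real.pi / 2 := by
  have h1 := Real.Gamma_pos_of_pos hm
  have h2 := Real.Gamma_pos_of_pos (by linarith : 0 < m + 1 / 2)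
  rw [ProbabilityTheory.beta, ProbabilityTheory.beta,
    show (3 : ℝ) / 2 + m = m + 1 / 2 + 1 by ring, show (1 : ℝ) / 2 + (m + 1 / 2) = m + 1 by ring,
    show (3 : ℝ) / 2 = 1 / 2 + 1 by ring, Real.Gamma_add_one hm.ne',
    Real.Gamma_add_one (by linarith : m + 1 / 2 ≠ 0), Real.Gamma_add_one (by norm_num),
    Real.Gamma_one_half_eq]
  have : Real.sqrt Real.pi ^ 2 = Real.pi := Real.sq_sqrt Real.pi_pos.le
  field_simp
  linear_combination this

lemma enorm_coord_smul {k : ℕ} (i : Fin k) (s : ℝ) (hs : 0 < s) (u : Cn k) :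
    ‖(s • u) i‖ₑ = posRpow 1 s * ‖u i‖ₑ := by
  rw [posRpow_one_of_pos hs, PiLp.smul_apply, enorm_smul, Real.enorm_of_nonneg hs.le]

lemma enorm_eq_posRpow (a : ℂ) : ‖a‖ₑ = posRpow 1 ‖a‖ := by
  by_cases h : a = 0
  · simp [h, posRpow_of_nonpos]
  · rw [posRpow_one_of_pos (norm_pos_iff.2 h), ofReal_norm]

/-- The factor `‖w 1‖` is homogeneous of degree 1 in the tail, so the marginal exponent rises by 1/2
while that of `‖1 - w 0‖` drops by 1. The two changes compensate, `cosIntegral m` appears again, and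
the remaining Beta factors yield `π/2` by `beta_mul_beta`. -/
lemma lintegral_coord_one_mul_one_sub_coord {k : ℕ} {α : ℝ} (hα : -1 < α) :
    ∫⁻ w : Cn (k + 2), posRpow (-(k + 2 + α + 1)) ‖1 - w 0‖ * ‖w 1‖ₑ
        ∂(weightedMeasure (k + 2) α) =
      ENNReal.ofReal (Real.pi / 2 *
        (Real.Gamma (k + 2 + α + 1) / Real.Gamma ((k + 2 + α) / 2 + 1) ^ 2)) := by
  have hk : (0 : ℝ) ≤ k := k.cast_nonneg
  set m : ℝ := k + 2 + α with hm_def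
  have hm : 0 < m := by linarith
  obtain ⟨hb, hb'⟩ := ballIntegral_ne_zero_ne_top hα (k + 1)
  set b := ballIntegral (k + 1) α
  set M := ∫⁻ u : Cn (k + 1), ‖u 0‖ₑ * posRpow α (1 - ‖u‖ ^ 2) with hM
  have hφ : Measurable fun u : Cn (k + 1) => ‖u 0‖ₑ := by fun_prop
  have e1 : α + ((k + 1 : ℕ) : ℝ) = m - 1 := by rw [hm_def]; push_cast; ring
  have hI : ballIntegral (k + 2) α = b * ENNReal.ofReal (Real.pi / m) := by
    rw [ballIntegral_succ hα, e1, sub_add_cancel]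
  -- The first absolute moment `M` is found by symmetry: in one dimension more, the integrals of `‖w
  -- 1‖` and `‖w 0‖` agree. Splitting off `w 0` expresses the former through `M` and makes the
  -- latter a disc integral.
  have hMb : M * ENNReal.ofReal (Real.pi / (m + 1 / 2)) =
      b * ENNReal.ofReal (Real.pi * ProbabilityTheory.beta (3 / 2) m) := by
    have hsym := lintegral_coord_eq hα (1 : Fin (k + 2)) 0
    rw [lintegral_weightedMeasure hα, lintegral_weightedMeasure hα] at hsym
    obtain ⟨hb2, hb2'⟩ := ballIntegral_ne_zero_ne_top hα (k + 2)
    have hsym := (ENNReal.mul_right_inj (ENNReal.inv_ne_zero.2 hb2')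
      (ENNReal.inv_ne_top.2 hb2)).1 hsym
    have l := lintegral_marginal (k := k + 1) (α := α) (j := 1) (h := fun _ => 1)
      measurable_const hφ (enorm_coord_smul 0)
    have r := lintegral_marginal_one (k := k + 1) (α := α) (h := fun a => ‖a‖ₑ) (by fun_prop)
    simp only [one_mul, tailCn_apply] at l
    rw [e1, lintegral_complex_posRpow (by linarith),
      show m - 1 + 1 / 2 + 1 = m + 1 / 2 by ring] at l
    simp only [enorm_eq_posRpow] at r
    rw [e1, lintegral_complex_norm_posRpow (by norm_num) (by linarith), sub_add_cancel,
      show (1 : ℝ) / 2 + 1 = 3 / 2 by norm_num] at r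
    rw [← l, ← r]
    simp only [enorm_eq_posRpow] at hsym ⊢
    exact hsym
  have h := lintegral_marginal (k := k + 1) (α := α) (j := 1)
    (h := fun a => posRpow (-(m + 1)) ‖1 - a‖) (by fun_prop) hφ (enorm_coord_smul 0)
  simp only [tailCn_apply] at h
  have hβ := ProbabilityTheory.beta_pos (by norm_num : (0 : ℝ) < 3 / 2) hm
  have hβ' := ProbabilityTheory.beta_pos (by norm_num : (0 : ℝ) < 1 / 2)
    (by linarith : 0 < m + 1 / 2)
  have hMe : M = b * ENNReal.ofReal ((m + 1 / 2) * ProbabilityTheory.beta (3 / 2) m) := by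
    have hd : 0 < Real.pi / (m + 1 / 2) := by positivity
    rw [← ENNReal.mul_left_inj (c := ENNReal.ofReal (Real.pi / (m + 1 / 2))) (by simpa using hd)
      ENNReal.ofReal_ne_top, hMb, mul_assoc, ← ENNReal.ofReal_mul (by positivity)]
    congr 2
    field_simp
  have h2 := lintegral_complex_one_sub_posRpow (q := m + 1) (p := m - 1 + 1 / 2) (by linarith)
    (by linarith)
  rw [e1, h2, show 2 - (m + 1) + (m - 1 + 1 / 2) = 1 / 2 by ring,
    show 2 - (m + 1) + 2 * (m - 1 + 1 / 2) = m by ring, show m - 1 + 1 / 2 + 1 = m + 1 / 2 by ring,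
    cosIntegral_eq hm, ← ENNReal.ofReal_mul hβ'.le, ← hM, hMe, mul_assoc,
    ← ENNReal.ofReal_mul (by positivity)] at h
  rw [lintegral_weightedMeasure hα]
  refine (congrArg _ h).trans ?_
  rw [hI, inv_mul_mul_cancel_left hb hb',
    ← ENNReal.ofReal_inv_of_pos (by positivity), ← ENNReal.ofReal_mul (by positivity)]
  congr 1
  rw [← beta_mul_beta hm]
  field_simp

/-! ### Values, continuity and upper bound of `ell`. -/

/-- The integrand of `ell`. -/
def ellIntegrand {n : ℕ} (hn : 1 < n) (α t : ℝ) (w : Cn n) : ℝ :=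
  ‖(1 - w ⟨0, Nat.zero_lt_of_lt hn⟩) * (Real.cos t : ℂ) + w ⟨1, hn⟩ * (Real.sin t : ℂ)‖ /
      ‖w ⟨0, Nat.zero_lt_of_lt hn⟩ - 1‖ ^ ((n : ℝ) + 1 + α)

lemma ell_eq {n : ℕ} (hn : 1 < n) (α t : ℝ) :
    ell hn α t = (n + 1 + α) * ∫ w, ellIntegrand hn α t w ∂(weightedMeasure n α) := rfl

lemma ellIntegrand_nonneg {n : ℕ} (hn : 1 < n) (α t : ℝ) (w : Cn n) :
    0 ≤ ellIntegrand hn α t w := by unfold ellIntegrand; positivity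

lemma measurable_ellIntegrand {n : ℕ} (hn : 1 < n) (α t : ℝ) :
    Measurable (ellIntegrand hn α t) := by
  unfold ellIntegrand
  fun_prop

lemma coord_ne_one {n : ℕ} {w : Cn n} (hw : w ∈ unitBall n) (i : Fin n) : w i ≠ 1 := by
  intro h
  have := norm_coord_le w i
  rw [h, norm_one] at this
  exact absurd (mem_unitBall.1 hw) (not_lt.2 this)

lemma lintegral_ellIntegrand_zero {n : ℕ} (hn : 1 < n) {α : ℝ} (hα : -1 < α) :
    ∫⁻ w, ENNReal.ofReal (ellIntegrand hn α 0 w) ∂(weightedMeasure n α) =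
      ENNReal.ofReal (Real.Gamma (n + α + 1) / Real.Gamma ((n + α) / 2 + 1) ^ 2) := by
  obtain ⟨k, rfl⟩ : ∃ k, n = k + 2 := ⟨n - 2, by omega⟩
  have hk : (0 : ℝ) ≤ k := k.cast_nonneg
  have h := lintegral_one_sub_coord (k := k + 1) hα (by push_cast; linarith)
  push_cast at h ⊢
  rw [show (k : ℝ) + 2 = k + 1 + 1 by ring, ← h]
  refine lintegral_congr_ae ?_
  filter_upwards [ae_weightedMeasure_mem (k + 2) α] with w hw
  have hpos : 0 < ‖1 - w 0‖ := norm_pos_iff.2 (sub_ne_zero.2 (coord_ne_one hw 0).symm)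
  rw [posRpow_of_pos hpos]
  congr 1
  have : ellIntegrand hn α 0 w = ‖1 - w 0‖ / ‖w 0 - 1‖ ^ (((k + 2 : ℕ) : ℝ) + 1 + α) := by
    simp [ellIntegrand]
  rw [this, norm_sub_rev (w 0), div_eq_iff (by positivity), ← Real.rpow_add hpos]
  push_cast
  rw [show -((k : ℝ) + 1 + 1 + α) + (k + 2 + 1 + α) = 1 by ring, Real.rpow_one]

lemma lintegral_ellIntegrand_pi_div_two {n : ℕ} (hn : 1 < n) {α : ℝ} (hα : -1 < α) :
    ∫⁻ w, ENNReal.ofReal (ellIntegrand hn α (Real.pi / 2) w) ∂(weightedMeasure n α) =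
      ENNReal.ofReal (Real.pi / 2 *
        (Real.Gamma (n + α + 1) / Real.Gamma ((n + α) / 2 + 1) ^ 2)) := by
  obtain ⟨k, rfl⟩ : ∃ k, n = k + 2 := ⟨n - 2, by omega⟩
  have h := lintegral_coord_one_mul_one_sub_coord (k := k) hα
  push_cast at h ⊢
  rw [← h]
  refine lintegral_congr_ae ?_
  filter_upwards [ae_weightedMeasure_mem (k + 2) α] with w hw
  have hpos : 0 < ‖1 - w 0‖ := norm_pos_iff.2 (sub_ne_zero.2 (coord_ne_one hw 0).symm)
  have : ellIntegrand hn α (Real.pi / 2) w =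
      ‖w 1‖ / ‖w 0 - 1‖ ^ (((k + 2 : ℕ) : ℝ) + 1 + α) := by
    simp [ellIntegrand]
  rw [posRpow_of_pos hpos, this, norm_sub_rev (w 0), ← ofReal_norm,
    ← ENNReal.ofReal_mul (by positivity), Real.rpow_neg hpos.le, mul_comm, div_eq_mul_inv]
  push_cast
  congr 4
  ring

lemma integrable_of_lintegral_eq {n : ℕ} {α : ℝ} {f : Cn n → ℝ} (hf : Measurable f)
    (h0 : ∀ w, 0 ≤ f w) {c : ℝ}
    (h : ∫⁻ w, ENNReal.ofReal (f w) ∂(weightedMeasure n α) = ENNReal.ofReal c) :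
    Integrable f (weightedMeasure n α) := by
  refine ⟨hf.aestronglyMeasurable, ?_⟩
  rw [hasFiniteIntegral_iff_ofReal (Filter.Eventually.of_forall h0), h]
  exact ENNReal.ofReal_lt_top

lemma integrable_ellIntegrand_zero {n : ℕ} (hn : 1 < n) {α : ℝ} (hα : -1 < α) :
    Integrable (ellIntegrand hn α 0) (weightedMeasure n α) :=
  integrable_of_lintegral_eq (measurable_ellIntegrand hn α 0) (ellIntegrand_nonneg hn α 0)
    (lintegral_ellIntegrand_zero hn hα)

lemma integrable_ellIntegrand_pi_div_two {n : ℕ} (hn : 1 < n) {α : ℝ} (hα : -1 < α) :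
    Integrable (ellIntegrand hn α (Real.pi / 2)) (weightedMeasure n α) :=
  integrable_of_lintegral_eq (measurable_ellIntegrand hn α _) (ellIntegrand_nonneg hn α _)
    (lintegral_ellIntegrand_pi_div_two hn hα)

lemma gammaQuotient_eq {n : ℕ} {α : ℝ} (hm : 0 < (n : ℝ) + α) :
    (n + 1 + α) * (Real.Gamma (n + α + 1) / Real.Gamma ((n + α) / 2 + 1) ^ 2) =
      blochConst n α := by
  rw [blochConst, show (2 : ℝ) + n + α = n + α + 1 + 1 by ring,
    Real.Gamma_add_one (by linarith : (n : ℝ) + α + 1 ≠ 0),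
    show ((n : ℝ) + α + 1 + 1) / 2 = (n + α) / 2 + 1 by ring]
  ring

lemma add_pos_of_one_lt {n : ℕ} (hn : 1 < n) {α : ℝ} (hα : -1 < α) : 0 < (n : ℝ) + α := by
  have : (1 : ℝ) < n := by exact_mod_cast hn
  linarith

lemma ell_zero {n : ℕ} (hn : 1 < n) {α : ℝ} (hα : -1 < α) : ell hn α 0 = blochConst n α := by
  have hm := add_pos_of_one_lt hn hα
  rw [ell_eq, integral_eq_lintegral_of_nonneg_ae
    (Filter.Eventually.of_forall (ellIntegrand_nonneg hn α 0))
    (measurable_ellIntegrand hn α 0).aestronglyMeasurable, lintegral_ellIntegrand_zero hn hα,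
    ENNReal.toReal_ofReal (by positivity), gammaQuotient_eq hm]

lemma ell_pi_div_two {n : ℕ} (hn : 1 < n) {α : ℝ} (hα : -1 < α) :
    ell hn α (Real.pi / 2) = Real.pi / 2 * blochConst n α := by
  have hm := add_pos_of_one_lt hn hα
  rw [ell_eq, integral_eq_lintegral_of_nonneg_ae
    (Filter.Eventually.of_forall (ellIntegrand_nonneg hn α _))
    (measurable_ellIntegrand hn α _).aestronglyMeasurable,
    lintegral_ellIntegrand_pi_div_two hn hα,
    ENNReal.toReal_ofReal (by positivity), mul_left_comm, gammaQuotient_eq hm]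

/-- The quantity inside the modulus is linear in `(cos t, sin t)`, and the moduli of its two
coefficients give the integrands at `0` and `π/2`. Integrated, this yields the continuity of `ell`.
-/
lemma ellIntegrand_sub_le {n : ℕ} (hn : 1 < n) (α s t : ℝ) (w : Cn n) :
    ellIntegrand hn α s w ≤ ellIntegrand hn α t w +
      (|Real.cos s - Real.cos t| * ellIntegrand hn α 0 w +
        |Real.sin s - Real.sin t| * ellIntegrand hn α (Real.pi / 2) w) := by
  unfold ellIntegrand
  rw [mul_div_assoc', mul_div_assoc', ← add_div, ← add_div]
  gcongr
  set a := 1 - w ⟨0, Nat.zero_lt_of_lt hn⟩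
  set b := w ⟨1, hn⟩
  have : a * (Real.cos s : ℂ) + b * (Real.sin s : ℂ) = a * (Real.cos t : ℂ) + b * (Real.sin t : ℂ) +
      (((Real.cos s - Real.cos t : ℝ) : ℂ) * a + ((Real.sin s - Real.sin t : ℝ) : ℂ) * b) := by
    push_cast; ring
  rw [this]
  refine (norm_add_le _ _).trans (add_le_add_right ((norm_add_le _ _).trans ?_) _)
  rw [norm_mul, norm_mul, Complex.norm_real, Complex.norm_real]
  simp

lemma ellIntegrand_le {n : ℕ} (hn : 1 < n) (α t : ℝ) (w : Cn n) :
    ellIntegrand hn α t w ≤ |Real.cos t| * ellIntegrand hn α 0 w +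
        |Real.sin t| * ellIntegrand hn α (Real.pi / 2) w := by
  unfold ellIntegrand
  rw [mul_div_assoc', mul_div_assoc', ← add_div]
  gcongr
  refine (norm_add_le _ _).trans ?_
  rw [norm_mul, norm_mul, Complex.norm_real, Complex.norm_real]
  simp [mul_comm]

lemma integrable_ellIntegrand {n : ℕ} (hn : 1 < n) {α : ℝ} (hα : -1 < α) (t : ℝ) :
    Integrable (ellIntegrand hn α t) (weightedMeasure n α) := by
  refine Integrable.mono' (((integrable_ellIntegrand_zero hn hα).const_mul |Real.cos t|).add
    ((integrable_ellIntegrand_pi_div_two hn hα).const_mul |Real.sin t|))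
    (measurable_ellIntegrand hn α t).aestronglyMeasurable (Filter.Eventually.of_forall fun w => ?_)
  rw [Real.norm_of_nonneg (ellIntegrand_nonneg hn α t w)]
  exact ellIntegrand_le hn α t w

lemma ofReal_ell {n : ℕ} (hn : 1 < n) {α : ℝ} (hα : -1 < α) (t : ℝ) :
    ENNReal.ofReal (ell hn α t) = ENNReal.ofReal (n + 1 + α) *
      ∫⁻ w, ENNReal.ofReal (ellIntegrand hn α t w) ∂(weightedMeasure n α) := by
  have hm := add_pos_of_one_lt hn hα
  rw [ell_eq, ENNReal.ofReal_mul (by linarith),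
    ofReal_integral_eq_lintegral_ofReal (integrable_ellIntegrand hn hα t)
      (Filter.Eventually.of_forall (ellIntegrand_nonneg hn α t))]

lemma ell_nonneg {n : ℕ} (hn : 1 < n) {α : ℝ} (hα : -1 < α) (t : ℝ) : 0 ≤ ell hn α t := by
  have hm := add_pos_of_one_lt hn hα
  exact mul_nonneg (by linarith) (integral_nonneg (ellIntegrand_nonneg hn α t))

lemma ell_le_add {n : ℕ} (hn : 1 < n) {α : ℝ} (hα : -1 < α) (s t : ℝ) :
    ell hn α s ≤ ell hn α t + (|Real.cos s - Real.cos t| * ell hn α 0 +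
      |Real.sin s - Real.sin t| * ell hn α (Real.pi / 2)) := by
  have hm := add_pos_of_one_lt hn hα
  have h0 := integrable_ellIntegrand_zero hn hα
  have h1 := integrable_ellIntegrand_pi_div_two hn hα
  have h := integral_mono (integrable_ellIntegrand hn hα s)
    ((integrable_ellIntegrand hn hα t).add
      ((h0.const_mul |Real.cos s - Real.cos t|).add (h1.const_mul |Real.sin s - Real.sin t|)))
    (ellIntegrand_sub_le hn α s t)
  rw [integral_add' (integrable_ellIntegrand hn hα t)
      ((h0.const_mul _).add (h1.const_mul _)),
    integral_add' (h0.const_mul _) (h1.const_mul _), integral_const_mul, integral_const_mul] at h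
  simp only [ell_eq]
  calc _ ≤ _ := mul_le_mul_of_nonneg_left h (by linarith)
    _ = _ := by ring

lemma continuous_ell {n : ℕ} (hn : 1 < n) {α : ℝ} (hα : -1 < α) : Continuous (ell hn α) := by
  refine continuous_iff_continuousAt.2 fun t => ?_
  rw [ContinuousAt, tendsto_iff_dist_tendsto_zero]
  have hb : Continuous fun s => |Real.cos s - Real.cos t| * ell hn α 0 +
      |Real.sin s - Real.sin t| * ell hn α (Real.pi / 2) := by fun_prop
  refine squeeze_zero (fun _ => dist_nonneg) (fun s => ?_) (by simpa using hb.tendsto t)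
  rw [Real.dist_eq, abs_le]
  have h1 := ell_le_add hn hα s t
  have h2 := ell_le_add hn hα t s
  rw [abs_sub_comm (Real.cos t), abs_sub_comm (Real.sin t)] at h2
  constructor <;> linarith

lemma ell_le_cos_add_sin {n : ℕ} (hn : 1 < n) {α : ℝ} (hα : -1 < α) (t : ℝ) :
    ell hn α t ≤ |Real.cos t| * ell hn α 0 + |Real.sin t| * ell hn α (Real.pi / 2) := by
  have hm := add_pos_of_one_lt hn hα
  have h0 := integrable_ellIntegrand_zero hn hα
  have h1 := integrable_ellIntegrand_pi_div_two hn hα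
  have h := integral_mono (integrable_ellIntegrand hn hα t)
    ((h0.const_mul |Real.cos t|).add (h1.const_mul |Real.sin t|)) (ellIntegrand_le hn α t)
  rw [integral_add' (h0.const_mul _) (h1.const_mul _), integral_const_mul, integral_const_mul] at h
  simp only [ell_eq]
  calc _ ≤ _ := mul_le_mul_of_nonneg_left h (by linarith)
    _ = _ := by ring

lemma ell_le {n : ℕ} (hn : 1 < n) {α : ℝ} (hα : -1 < α) (t : ℝ) :
    ell hn α t ≤ Real.sqrt (Real.pi ^ 2 + 4) / 2 * blochConst n α := by
  have hC : 0 ≤ blochConst n α := by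
    rw [← ell_zero hn hα]; exact ell_nonneg hn hα 0
  have h := ell_le_cos_add_sin hn hα t
  rw [ell_zero hn hα, ell_pi_div_two hn hα] at h
  have : |Real.cos t| + Real.pi / 2 * |Real.sin t| ≤ Real.sqrt (Real.pi ^ 2 + 4) / 2 := by
    rw [le_div_iff₀ two_pos]
    refine Real.le_sqrt_of_sq_le ?_
    have := Real.sin_sq_add_cos_sq t
    rw [← sq_abs (Real.sin t), ← sq_abs (Real.cos t)] at this
    -- Lagrange's identity: `(2c + πs)² + (πc - 2s)² = (π² + 4)(c² + s²)`.
    nlinarith [sq_nonneg (Real.pi * |Real.cos t| - 2 * |Real.sin t|)]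
  nlinarith

/-! ### The pairing and the involutions of the ball. -/

section Pairing

variable {n : ℕ} (c : ℂ) (x y z : Cn n)

lemma pairing_add_left : pairing (x + y) z = pairing x z + pairing y z := inner_add_right _ _ _

lemma pairing_sub_left : pairing (x - y) z = pairing x z - pairing y z := inner_sub_right _ _ _

lemma pairing_smul_left : pairing (c • x) z = c * pairing x z := inner_smul_right _ _ _

lemma pairing_add_right : pairing x (y + z) = pairing x y + pairing x z := inner_add_left _ _ _

lemma pairing_sub_right : pairing x (y - z) = pairing x y - pairing x z := inner_sub_left _ _ _

lemma pairing_smul_right : pairing x (c • z) = conj c * pairing x z := inner_smul_left _ _ _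

lemma conj_pairing : conj (pairing x y) = pairing y x := inner_conj_symm _ _

lemma pairing_self : pairing x x = ((‖x‖ ^ 2 : ℝ) : ℂ) := by
  rw [pairing, inner_self_eq_norm_sq_to_K]
  norm_cast

@[simp] lemma pairing_zero_left : pairing 0 x = 0 := inner_zero_right _

@[simp] lemma pairing_zero_right : pairing x 0 = 0 := inner_zero_left _

lemma norm_pairing_le : ‖pairing x y‖ ≤ ‖x‖ * ‖y‖ := by
  rw [mul_comm]; exact norm_inner_le_norm _ _

lemma norm_pairing_comm : ‖pairing x y‖ = ‖pairing y x‖ := by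
  rw [← conj_pairing, RCLike.norm_conj]

lemma norm_one_sub_pairing_comm : ‖1 - pairing x y‖ = ‖1 - pairing y x‖ := by
  rw [← conj_pairing, ← RCLike.norm_conj, map_sub, Complex.conj_conj, map_one]

variable {x y}

lemma norm_pairing_lt_one (hx : ‖x‖ ≤ 1) (hy : ‖y‖ < 1) : ‖pairing x y‖ < 1 :=
  (norm_pairing_le x y).trans_lt (by nlinarith [norm_nonneg x, norm_nonneg y])

lemma one_sub_mem_slitPlane {p : ℂ} (h : ‖p‖ < 1) : 1 - p ∈ Complex.slitPlane := by
  refine Or.inl ?_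
  have := (Complex.re_le_norm p).trans_lt h
  simp only [Complex.sub_re, Complex.one_re]
  linarith

lemma one_sub_pairing_ne_zero (hx : ‖x‖ ≤ 1) (hy : ‖y‖ < 1) : 1 - pairing x y ≠ 0 :=
  Complex.slitPlane_ne_zero (one_sub_mem_slitPlane (norm_pairing_lt_one hx hy))

lemma one_sub_pairing_ne_zero' (hx : ‖x‖ < 1) (hy : ‖y‖ ≤ 1) : 1 - pairing x y ≠ 0 := by
  rw [← norm_ne_zero_iff, norm_one_sub_pairing_comm, norm_ne_zero_iff]
  exact one_sub_pairing_ne_zero hy hx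

end Pairing

/-- The number `√(1 - |a|²)`. -/
def coNorm {n : ℕ} (a : Cn n) : ℝ := Real.sqrt (1 - ‖a‖ ^ 2)

section Involution

variable {n : ℕ} {a : Cn n}

lemma coNorm_pos (ha : ‖a‖ < 1) : 0 < coNorm a :=
  Real.sqrt_pos.2 (by nlinarith [norm_nonneg a])

lemma coNorm_sq (ha : ‖a‖ < 1) : coNorm a ^ 2 = 1 - ‖a‖ ^ 2 :=
  Real.sq_sqrt (by nlinarith [norm_nonneg a])

lemma pairing_self_eq_coNorm (ha : ‖a‖ < 1) : pairing a a = 1 - (coNorm a : ℂ) ^ 2 := by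
  rw [pairing_self, ← Complex.ofReal_pow, coNorm_sq ha]
  push_cast
  ring

lemma coNorm_ne_zero (ha : ‖a‖ < 1) : (coNorm a : ℂ) ≠ 0 :=
  Complex.ofReal_ne_zero.2 (coNorm_pos ha).ne'

lemma one_add_coNorm_ne_zero (ha : ‖a‖ < 1) : 1 + (coNorm a : ℂ) ≠ 0 := by
  have := coNorm_pos ha
  exact_mod_cast (by positivity : (1 + coNorm a) ≠ 0)

/-- With `s = √(1 - |a|²)` one has `(1 - s)/|a|² = 1/(1 + s)`. This removes the division by `|a|²`
and covers `a = 0` by the same formula. -/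
lemma ballInvolution_eq (ha : ‖a‖ < 1) (ω : Cn n) :
    ballInvolution a ω = (1 - pairing ω a)⁻¹ •
      (a - (coNorm a : ℂ) • ω - (pairing ω a * (1 + (coNorm a : ℂ))⁻¹) • a) := by
  by_cases h : a = 0
  · subst h
    simp [ballInvolution, coNorm]
  · have h1 := one_add_coNorm_ne_zero ha
    have h2 : ((‖a‖ ^ 2 : ℝ) : ℂ) = 1 - (coNorm a : ℂ) ^ 2 := by
      rw [← pairing_self, pairing_self_eq_coNorm ha]
    have h3 : 1 - (coNorm a : ℂ) ≠ 0 := by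
      intro h0
      have h4 : ((‖a‖ ^ 2 : ℝ) : ℂ) = 0 := by
        rw [h2]; linear_combination (1 + (coNorm a : ℂ)) * h0
      exact h (by simpa using h4)
    have h5 : (1 : ℂ) - (coNorm a : ℂ) ^ 2 ≠ 0 := by
      rw [show (1 : ℂ) - (coNorm a : ℂ) ^ 2 = (1 - coNorm a) * (1 + coNorm a) by ring]
      exact mul_ne_zero h3 h1
    rw [ballInvolution, if_neg h, h2, one_div]
    congr 1
    rw [← coNorm]
    match_scalars
    · field_simp
      ring
    · ring

lemma ballInvolution_zero (ha : ‖a‖ < 1) : ballInvolution a 0 = a := by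
  simp [ballInvolution_eq ha]

lemma one_sub_pairing_ballInvolution (ha : ‖a‖ < 1) {ω η : Cn n} (hω : ‖ω‖ < 1) (hη : ‖η‖ < 1) :
    1 - pairing (ballInvolution a ω) (ballInvolution a η) =
      (coNorm a : ℂ) ^ 2 * (1 - pairing ω η) / ((1 - pairing ω a) * (1 - pairing a η)) := by
  have h1 := one_add_coNorm_ne_zero ha
  have h2 := one_sub_pairing_ne_zero hω.le ha
  have h3 := one_sub_pairing_ne_zero ha.le hη
  rw [ballInvolution_eq ha, ballInvolution_eq ha]
  simp only [pairing_smul_left, pairing_smul_right, pairing_sub_left, pairing_sub_right,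
    map_mul, map_inv₀, map_sub, map_add, map_one, conj_pairing, Complex.conj_ofReal,
    pairing_self_eq_coNorm ha]
  field_simp
  ring

lemma one_sub_pairing_ballInvolution_self (ha : ‖a‖ < 1) {ω : Cn n} (hω : ‖ω‖ < 1) :
    1 - pairing (ballInvolution a ω) a = (coNorm a : ℂ) ^ 2 / (1 - pairing ω a) := by
  have := one_sub_pairing_ballInvolution ha hω (η := 0) (by simp)
  simpa [ballInvolution_zero ha] using this

lemma one_sub_pairing_self_ballInvolution (ha : ‖a‖ < 1) {η : Cn n} (hη : ‖η‖ < 1) :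
    1 - pairing a (ballInvolution a η) = (coNorm a : ℂ) ^ 2 / (1 - pairing a η) := by
  have := one_sub_pairing_ballInvolution ha (ω := 0) (by simp) hη
  simpa [ballInvolution_zero ha] using this

lemma one_sub_norm_ballInvolution_sq (ha : ‖a‖ < 1) {η : Cn n} (hη : ‖η‖ < 1) :
    1 - ‖ballInvolution a η‖ ^ 2 =
      coNorm a ^ 2 / ‖1 - pairing a η‖ ^ 2 * (1 - ‖η‖ ^ 2) := by
  have h := one_sub_pairing_ballInvolution ha hη hη
  have h2 : (1 - pairing η a) * (1 - pairing a η) = ((‖1 - pairing a η‖ ^ 2 : ℝ) : ℂ) := by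
    rw [Complex.ofReal_pow, ← Complex.conj_mul', map_sub, conj_pairing, map_one]
  rw [h2, pairing_self, pairing_self] at h
  rw [div_mul_eq_mul_div]
  exact_mod_cast h

lemma norm_ballInvolution_lt_one (ha : ‖a‖ < 1) {η : Cn n} (hη : ‖η‖ < 1) :
    ‖ballInvolution a η‖ < 1 := by
  have h := one_sub_norm_ballInvolution_sq ha hη
  have h1 := coNorm_pos ha
  have h2 : 0 < ‖1 - pairing a η‖ := norm_pos_iff.2 (one_sub_pairing_ne_zero ha.le hη)
  have h3 : 0 < 1 - ‖η‖ ^ 2 := by nlinarith [norm_nonneg η]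
  have h4 : 0 < 1 - ‖ballInvolution a η‖ ^ 2 := by rw [h]; positivity
  nlinarith [norm_nonneg (ballInvolution a η)]

lemma ballInvolution_ballInvolution (ha : ‖a‖ < 1) {η : Cn n} (hη : ‖η‖ < 1) :
    ballInvolution a (ballInvolution a η) = η := by
  have h0 := coNorm_ne_zero ha
  have h1 := one_add_coNorm_ne_zero ha
  have h2 := one_sub_pairing_ne_zero hη.le ha
  have h3 := one_sub_pairing_ballInvolution_self ha hη
  have h4 : pairing (ballInvolution a η) a = 1 - (coNorm a : ℂ) ^ 2 / (1 - pairing η a) := by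
    rw [← h3]; ring
  rw [ballInvolution_eq ha (ballInvolution a η), h3, h4, ballInvolution_eq ha η]
  match_scalars
  · field_simp
    ring
  · field_simp

lemma image_ballInvolution (ha : ‖a‖ < 1) :
    ballInvolution a '' unitBall n = unitBall n := by
  ext w
  constructor
  · rintro ⟨η, hη, rfl⟩
    exact mem_unitBall.2 (norm_ballInvolution_lt_one ha (mem_unitBall.1 hη))
  · intro hw
    exact ⟨ballInvolution a w, mem_unitBall.2 (norm_ballInvolution_lt_one ha (mem_unitBall.1 hw)),
      ballInvolution_ballInvolution ha (mem_unitBall.1 hw)⟩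

lemma injOn_ballInvolution (ha : ‖a‖ < 1) : InjOn (ballInvolution a) (unitBall n) := by
  intro x hx y hy h
  rw [← ballInvolution_ballInvolution ha (mem_unitBall.1 hx), h,
    ballInvolution_ballInvolution ha (mem_unitBall.1 hy)]

/-! ### Derivative and Jacobian of the involutions, change of variables. -/

/-- The complex derivative of `ballInvolution a` at `η`. -/
def involutionDeriv (a η : Cn n) : Cn n →L[ℂ] Cn n :=
  (1 - pairing η a)⁻¹ • (-(coNorm a : ℂ) • ContinuousLinearMap.id ℂ (Cn n) +
    (innerSL ℂ a).smulRight (ballInvolution a η - (1 + (coNorm a : ℂ))⁻¹ • a))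

lemma involutionDeriv_apply (a η h : Cn n) : involutionDeriv a η h =
    (1 - pairing η a)⁻¹ • (-(coNorm a : ℂ) • h +
      pairing h a • (ballInvolution a η - (1 + (coNorm a : ℂ))⁻¹ • a)) := rfl

lemma innerSL_eq_pairing (a v : Cn n) : innerSL ℂ a v = pairing v a := rfl

lemma hasFDerivAt_pairing_left (a z : Cn n) :
    HasFDerivAt (fun ω => pairing ω a) (innerSL ℂ a) z := (innerSL ℂ a).hasFDerivAt

lemma hasFDerivAt_ballInvolution (ha : ‖a‖ < 1) {η : Cn n} (hη : ‖η‖ < 1) :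
    HasFDerivAt (ballInvolution a) (involutionDeriv a η) η := by
  have h2 := one_sub_pairing_ne_zero hη.le ha
  have hp := hasFDerivAt_pairing_left a η
  have hD := (hasDerivAt_inv h2).comp_hasFDerivAt η (hp.const_sub 1)
  have hN := (((hasFDerivAt_id η).const_smul (coNorm a : ℂ)).const_sub a).sub
    ((hp.mul_const (1 + (coNorm a : ℂ))⁻¹).smul_const a)
  have h := hD.smul hN
  have he : ballInvolution a = _ := funext fun ω => ballInvolution_eq ha ω
  have hv := ballInvolution_eq ha η
  rw [he]
  refine h.congr_fderiv ?_
  ext1 v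
  rw [involutionDeriv_apply, hv]
  simp only [add_apply, smul_apply,
    sub_apply, neg_apply,
    ContinuousLinearMap.smulRight_apply, ContinuousLinearMap.id_apply, innerSL_eq_pairing,
    Function.comp_apply, id_eq, Pi.sub_apply, Pi.smul_apply]
  match_scalars
  all_goals simp
  all_goals field_simp
  all_goals ring

/-- The derivative is a scalar multiple of the identity plus a rank-one map, that is of a
transvection, whose determinant is `1 + ⟨v, a⟩`. -/
lemma det_involutionDeriv (ha : ‖a‖ < 1) {η : Cn n} (hη : ‖η‖ < 1) :
    LinearMap.det (involutionDeriv a η : Cn n →ₗ[ℂ] Cn n) =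
      (-1) ^ n * ((coNorm a : ℂ) / (1 - pairing η a)) ^ (n + 1) := by
  have h0 := coNorm_ne_zero ha
  have h1 := one_add_coNorm_ne_zero ha
  have h2 := one_sub_pairing_ne_zero hη.le ha
  set v : Cn n := -(coNorm a : ℂ)⁻¹ • (ballInvolution a η - (1 + (coNorm a : ℂ))⁻¹ • a)
  have he : (involutionDeriv a η : Cn n →ₗ[ℂ] Cn n) =
      ((1 - pairing η a)⁻¹ * -(coNorm a : ℂ)) •
        LinearMap.transvection ((innerSL ℂ a : Cn n →L[ℂ] ℂ) : Cn n →ₗ[ℂ] ℂ) v := by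
    ext1 h
    simp only [ContinuousLinearMap.coe_coe, involutionDeriv_apply, LinearMap.smul_apply,
      LinearMap.transvection.apply, innerSL_eq_pairing, v]
    match_scalars <;> field_simp
  have hv : pairing v a = -1 + (coNorm a : ℂ) / (1 - pairing η a) := by
    have h4 : pairing (ballInvolution a η) a = 1 - (coNorm a : ℂ) ^ 2 / (1 - pairing η a) := by
      rw [← one_sub_pairing_ballInvolution_self ha hη]; ring
    simp only [v, pairing_smul_left, pairing_sub_left, h4, pairing_self_eq_coNorm ha]
    field_simp
    ring
  rw [he, LinearMap.det_smul, LinearMap.transvection.det, finrank_euclideanSpace_fin]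
  have : ((innerSL ℂ a : Cn n →L[ℂ] ℂ) : Cn n →ₗ[ℂ] ℂ) v = pairing v a := rfl
  rw [this, hv, pow_succ, div_eq_mul_inv, mul_pow, mul_pow, neg_pow]
  ring

lemma abs_det_restrictScalars_involutionDeriv (ha : ‖a‖ < 1) {η : Cn n} (hη : ‖η‖ < 1) :
    |((involutionDeriv a η).restrictScalars ℝ).det| =
      (coNorm a ^ 2 / ‖1 - pairing a η‖ ^ 2) ^ (n + 1) := by
  -- The real determinant of a complex linear map is the squared modulus of its complex determinant.
  have h : ((involutionDeriv a η).restrictScalars ℝ).det =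
      Algebra.norm ℝ (LinearMap.det (involutionDeriv a η : Cn n →ₗ[ℂ] Cn n)) :=
    LinearMap.det_restrictScalars
  rw [h, det_involutionDeriv ha hη, Algebra.norm_complex_apply, Complex.normSq_eq_norm_sq,
    abs_of_nonneg (by positivity), norm_mul, norm_pow, norm_neg, norm_one, one_pow, one_mul,
    norm_pow, norm_div, Complex.norm_real, Real.norm_of_nonneg (coNorm_pos ha).le,
    norm_one_sub_pairing_comm]
  ring

lemma lintegral_weightedMeasure_eq_setLIntegral {α : ℝ} (hα : -1 < α) (f : Cn n → ℝ≥0∞) :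
    ∫⁻ w, f w ∂(weightedMeasure n α) =
      (ballIntegral n α)⁻¹ * ∫⁻ w in unitBall n, f w * posRpow α (1 - ‖w‖ ^ 2) := by
  rw [lintegral_weightedMeasure hα, ← setLIntegral_unitBall]
  congr 1
  refine setLIntegral_congr_fun (measurableSet_unitBall n) fun w hw => ?_
  have : 0 < 1 - ‖w‖ ^ 2 := by
    have := mem_unitBall.1 hw
    nlinarith [norm_nonneg w]
  rw [posRpow_of_pos this, mul_comm]

/-- The transformation of the weighted measure under the involutions of the ball. -/
lemma lintegral_comp_ballInvolution {α : ℝ} (hα : -1 < α) (ha : ‖a‖ < 1) (f : Cn n → ℝ≥0∞) :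
    ∫⁻ w, f w ∂(weightedMeasure n α) =
      ∫⁻ η, ENNReal.ofReal ((coNorm a ^ 2 / ‖1 - pairing a η‖ ^ 2) ^ ((n : ℝ) + 1 + α)) *
        f (ballInvolution a η) ∂(weightedMeasure n α) := by
  rw [lintegral_weightedMeasure_eq_setLIntegral hα, lintegral_weightedMeasure_eq_setLIntegral hα]
  congr 1
  have h := lintegral_image_eq_lintegral_abs_det_fderiv_mul volume (measurableSet_unitBall n)
    (f := ballInvolution a) (f' := fun η => (involutionDeriv a η).restrictScalars ℝ)
    (fun η hη => ((hasFDerivAt_ballInvolution ha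
      (mem_unitBall.1 hη)).restrictScalars ℝ).hasFDerivWithinAt)
    (injOn_ballInvolution ha) (fun w => f w * posRpow α (1 - ‖w‖ ^ 2))
  rw [image_ballInvolution ha] at h
  rw [h]
  refine setLIntegral_congr_fun (measurableSet_unitBall n) fun η hη => ?_
  have hη := mem_unitBall.1 hη
  have hpos : 0 < coNorm a ^ 2 / ‖1 - pairing a η‖ ^ 2 :=
    div_pos (pow_pos (coNorm_pos ha) 2)
      (pow_pos (norm_pos_iff.2 (one_sub_pairing_ne_zero ha.le hη)) 2)
  simp only
  -- The Jacobian contributes the exponent `n + 1` and the weight contributes `α`.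
  rw [abs_det_restrictScalars_involutionDeriv ha hη, one_sub_norm_ballInvolution_sq ha hη,
    posRpow_mul_left hpos, posRpow_of_pos hpos, Real.rpow_add hpos,
    ENNReal.ofReal_mul (by positivity), ← Real.rpow_natCast]
  push_cast
  ring

end Involution

/-! ### The Bergman kernel and differentiation of the projection. -/

/-- The complex derivative in `z` of the weighted Bergman kernel. -/
def kernelDeriv {n : ℕ} (α : ℝ) (z w : Cn n) : Cn n →L[ℂ] ℂ :=
  (((n : ℂ) + 1 + α) * (1 - pairing z w) ^ (-((n : ℂ) + 1 + α) - 1)) • innerSL ℂ w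

section Kernel

variable {n : ℕ} {α : ℝ}

lemma kernelDeriv_apply (z w v : Cn n) : kernelDeriv α z w v =
    ((n : ℂ) + 1 + α) * (1 - pairing z w) ^ (-((n : ℂ) + 1 + α) - 1) * pairing v w := rfl

lemma bergmanKernel_eq (z w : Cn n) :
    bergmanKernel α z w = (1 - pairing z w) ^ (-((n : ℂ) + 1 + α)) := by
  rw [bergmanKernel, Complex.cpow_neg, one_div]

lemma hasFDerivAt_bergmanKernel {z w : Cn n} (hz : ‖z‖ < 1) (hw : ‖w‖ < 1) :
    HasFDerivAt (fun z => bergmanKernel α z w) (kernelDeriv α z w) z := by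
  simp only [bergmanKernel_eq]
  have hs := one_sub_mem_slitPlane (norm_pairing_lt_one hz.le hw)
  have h := (Complex.hasStrictDerivAt_cpow_const (c := -((n : ℂ) + 1 + α)) hs).hasDerivAt
  refine (h.comp_hasFDerivAt z ((hasFDerivAt_pairing_left w z).const_sub 1)).congr_fderiv ?_
  ext v
  rw [kernelDeriv_apply, smul_apply, neg_apply, innerSL_eq_pairing, smul_eq_mul]
  ring

lemma norm_cpow_neg_sub_one (p : ℂ) :
    ‖p ^ (-((n : ℂ) + 1 + α) - 1)‖ = ‖p‖ ^ (-((n : ℝ) + 1 + α) - 1) := by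
  rw [← Complex.norm_cpow_real]
  push_cast
  rfl

lemma norm_exponent (h : 0 < (n : ℝ) + α) : ‖(n : ℂ) + 1 + α‖ = n + 1 + α := by
  rw [show (n : ℂ) + 1 + α = ((n + 1 + α : ℝ) : ℂ) by push_cast; rfl, Complex.norm_real,
    Real.norm_of_nonneg (by linarith)]

lemma norm_kernelDeriv_le (hm : 0 < (n : ℝ) + α) {z w : Cn n} {r : ℝ} (hr : r < 1) (hz : ‖z‖ ≤ r)
    (hw : ‖w‖ < 1) :
    ‖kernelDeriv α z w‖ ≤ (n + 1 + α) * (1 - r) ^ (-((n : ℝ) + 1 + α) - 1) := by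
  rw [kernelDeriv, norm_smul, norm_mul, norm_exponent hm, norm_cpow_neg_sub_one, innerSL_apply_norm]
  have h1 : 1 - r ≤ ‖1 - pairing z w‖ := by
    have h2 := norm_sub_norm_le 1 (pairing z w)
    have h3 := norm_pairing_le z w
    rw [norm_one] at h2
    nlinarith [norm_nonneg z, norm_nonneg w]
  have h4 := Real.rpow_le_rpow_of_nonpos (by linarith : 0 < 1 - r) h1
    (by linarith : -((n : ℝ) + 1 + α) - 1 ≤ 0)
  calc _ ≤ (n + 1 + α) * (1 - r) ^ (-((n : ℝ) + 1 + α) - 1) * 1 := by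
        have hN : 0 ≤ (n : ℝ) + 1 + α := by linarith
        have hR : 0 ≤ (1 - r) ^ (-((n : ℝ) + 1 + α) - 1) := Real.rpow_nonneg (by linarith) _
        gcongr
    _ = _ := mul_one _

lemma measurable_pairing_right (z : Cn n) : Measurable (fun w => pairing z w) := by
  unfold pairing; fun_prop

lemma measurable_bergmanKernel (z : Cn n) : Measurable (fun w => bergmanKernel α z w) := by
  have := measurable_pairing_right z
  simp only [bergmanKernel_eq]
  fun_prop

lemma measurable_kernelDeriv_apply (z v : Cn n) : Measurable (fun w => kernelDeriv α z w v) := by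
  have := measurable_pairing_right z
  have := measurable_pairing_right v
  simp only [kernelDeriv_apply]
  fun_prop

lemma aestronglyMeasurable_kernelDeriv (μ : Measure (Cn n)) (z : Cn n) :
    AEStronglyMeasurable (fun w => kernelDeriv α z w) μ := by
  have := measurable_pairing_right z
  have h : Measurable fun w : Cn n =>
      ((n : ℂ) + 1 + α) * (1 - pairing z w) ^ (-((n : ℂ) + 1 + α) - 1) := by fun_prop
  exact h.aestronglyMeasurable.smul (innerSL ℂ (E := Cn n)).continuous.aestronglyMeasurable

lemma norm_bergmanKernel_le (hm : 0 < (n : ℝ) + α) {z w : Cn n} (hz : ‖z‖ < 1) (hw : ‖w‖ < 1) :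
    ‖bergmanKernel α z w‖ ≤ (1 - ‖z‖) ^ (-((n : ℝ) + 1 + α)) := by
  have h1 : 1 - ‖z‖ ≤ ‖1 - pairing z w‖ := by
    have h2 := norm_sub_norm_le 1 (pairing z w)
    have h3 := norm_pairing_le z w
    rw [norm_one] at h2
    nlinarith [norm_nonneg z, norm_nonneg w]
  rw [bergmanKernel_eq, show -((n : ℂ) + 1 + α) = ((-((n : ℝ) + 1 + α) : ℝ) : ℂ) by push_cast; rfl,
    Complex.norm_cpow_real]
  exact Real.rpow_le_rpow_of_nonpos (by linarith) h1 (by linarith)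

/-- Differentiation of the Bergman projection under the integral sign. -/
lemma hasFDerivAt_bergmanProj (hm : 0 < (n : ℝ) + α) {g : Cn n → ℂ}
    (hg : Integrable g (weightedMeasure n α)) {a : Cn n} (ha : ‖a‖ < 1) :
    Integrable (fun w => g w • kernelDeriv α a w) (weightedMeasure n α) ∧
    HasFDerivAt (bergmanProj α g) (∫ w, g w • kernelDeriv α a w ∂(weightedMeasure n α)) a := by
  -- A radius strictly between `‖a‖` and 1 bounds the kernel derivative uniformly for `z` near `a`.
  set r := (1 + ‖a‖) / 2 with hr
  have hr1 : r < 1 := by linarith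
  have hs : Metric.ball (0 : Cn n) r ∈ nhds a :=
    Metric.isOpen_ball.mem_nhds (mem_ball_zero_iff.2 (by linarith))
  have hmeas : AEStronglyMeasurable (fun w => g w • kernelDeriv α a w) (weightedMeasure n α) :=
    hg.aestronglyMeasurable.smul (aestronglyMeasurable_kernelDeriv _ a)
  have hbound : ∀ᵐ w ∂(weightedMeasure n α), ∀ z ∈ Metric.ball (0 : Cn n) r,
      ‖g w • kernelDeriv α z w‖ ≤
        ‖g w‖ * ((n + 1 + α) * (1 - r) ^ (-((n : ℝ) + 1 + α) - 1)) := by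
    filter_upwards [ae_weightedMeasure_mem n α] with w hw z hz
    rw [norm_smul]
    gcongr
    exact norm_kernelDeriv_le hm hr1 (mem_ball_zero_iff.1 hz).le (mem_unitBall.1 hw)
  have hbi : Integrable (fun w => ‖g w‖ * ((n + 1 + α) * (1 - r) ^ (-((n : ℝ) + 1 + α) - 1)))
      (weightedMeasure n α) := hg.norm.mul_const _
  refine ⟨hbi.mono' hmeas (hbound.mono fun w hw => hw a (mem_of_mem_nhds hs)), ?_⟩
  refine hasFDerivAt_integral_of_dominated_of_fderiv_le hs
    (F := fun z w => bergmanKernel α z w * g w) (F' := fun z w => g w • kernelDeriv α z w)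
    (Filter.Eventually.of_forall fun z =>
      (measurable_bergmanKernel z).aestronglyMeasurable.mul hg.aestronglyMeasurable) ?_
    hmeas hbound hbi ?_
  · refine Integrable.mono' (hg.norm.const_mul ((1 - ‖a‖) ^ (-((n : ℝ) + 1 + α))))
      ((measurable_bergmanKernel a).aestronglyMeasurable.mul hg.aestronglyMeasurable) ?_
    filter_upwards [ae_weightedMeasure_mem n α] with w hw
    rw [norm_mul]
    gcongr
    exact norm_bergmanKernel_le hm ha (mem_unitBall.1 hw)
  · filter_upwards [ae_weightedMeasure_mem n α] with w hw z hz
    refine ((hasFDerivAt_bergmanKernel ((mem_ball_zero_iff.1 hz).trans hr1)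
      (mem_unitBall.1 hw)).mul_const (g w))

lemma integrable_of_memLp_top (hα : -1 < α) {g : Cn n → ℂ} (hg : MemLp g ∞ (ballMeasure n)) :
    Integrable g (weightedMeasure n α) := by
  have := isProbabilityMeasure_weightedMeasure (n := n) hα
  have hac := weightedMeasure_absolutelyContinuous n α
  have h : MemLp g ∞ (weightedMeasure n α) :=
    ⟨hg.1.mono_ac hac, (eLpNormEssSup_mono_measure g hac).trans_lt hg.2⟩
  exact h.integrable le_top

/-- The derivative at the origin of `P_α g ∘ φ_a`. -/
lemma fderiv_bergmanProj_comp (hm : 0 < (n : ℝ) + α) {g : Cn n → ℂ}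
    (hg : Integrable g (weightedMeasure n α)) {a : Cn n} (ha : ‖a‖ < 1) (ξ : Cn n) :
    fderiv ℂ (fun ω => bergmanProj α g (ballInvolution a ω)) 0 ξ =
      ∫ w, g w * kernelDeriv α a w (involutionDeriv a 0 ξ) ∂(weightedMeasure n α) := by
  obtain ⟨hi, hd⟩ := hasFDerivAt_bergmanProj hm hg ha
  have hφ := hasFDerivAt_ballInvolution ha (η := 0) (by simp)
  rw [← ballInvolution_zero ha] at hd
  have h := (hd.comp (0 : Cn n) hφ).fderiv
  rw [ballInvolution_zero ha] at h
  have h' : fderiv ℂ (fun ω => bergmanProj α g (ballInvolution a ω)) 0 = _ := h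
  rw [h', ContinuousLinearMap.comp_apply, ContinuousLinearMap.integral_apply hi]
  rfl

/-! ### Duality: the norm as a supremum of `gradientMass`. -/

/-- The integral whose supremum is the norm of the Bergman projection. -/
def gradientMass (α : ℝ) (a ξ : Cn n) : ℝ≥0∞ :=
  ENNReal.ofReal (n + 1 + α) *
    ∫⁻ η, ENNReal.ofReal (‖pairing (η - a) ξ‖ / ‖1 - pairing η a‖ ^ ((n : ℝ) + 1 + α))
      ∂(weightedMeasure n α)

/-- Two identities drive the cancellation: `⟨φ_a'(0)ξ, φ_a(η)⟩ = s²⟨ξ, η - a⟩/(1 - ⟨a,η⟩)` and `1 -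
⟨a, φ_a(η)⟩ = s²/(1 - ⟨a,η⟩)`, where `s = coNorm a`. All powers of `s` disappear, which is why the
result still makes sense on the sphere. -/
lemma norm_kernelDeriv_involution (hm : 0 < (n : ℝ) + α) {a η : Cn n} (ha : ‖a‖ < 1)
    (hη : ‖η‖ < 1) (ξ : Cn n) :
    (coNorm a ^ 2 / ‖1 - pairing a η‖ ^ 2) ^ ((n : ℝ) + 1 + α) *
      ‖kernelDeriv α a (ballInvolution a η) (involutionDeriv a 0 ξ)‖ =
    (n + 1 + α) * (‖pairing (η - a) ξ‖ / ‖1 - pairing η a‖ ^ ((n : ℝ) + 1 + α)) := by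
  have h1 := one_add_coNorm_ne_zero ha
  have h3 := one_sub_pairing_ne_zero ha.le hη
  have hp : pairing (involutionDeriv a 0 ξ) (ballInvolution a η) =
      (coNorm a : ℂ) ^ 2 * pairing ξ (η - a) / (1 - pairing a η) := by
    rw [involutionDeriv_apply, ballInvolution_zero ha, ballInvolution_eq ha]
    simp only [pairing_smul_left, pairing_smul_right, pairing_sub_left, pairing_sub_right,
      pairing_add_left, map_mul, map_inv₀, map_sub, map_add, map_one, conj_pairing,
      Complex.conj_ofReal, pairing_self_eq_coNorm ha, pairing_zero_left]
    field_simp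
    ring
  have hs := coNorm_pos ha
  have hE : 0 < ‖1 - pairing a η‖ := norm_pos_iff.2 h3
  rw [kernelDeriv_apply, norm_mul, norm_mul, norm_exponent hm, norm_cpow_neg_sub_one, hp,
    one_sub_pairing_self_ballInvolution ha hη, norm_div, norm_div, norm_mul, norm_pow,
    Complex.norm_real, Real.norm_of_nonneg hs.le, norm_one_sub_pairing_comm η a,
    norm_pairing_comm (η - a)]
  set N : ℝ := (n : ℝ) + 1 + α
  set E := ‖1 - pairing a η‖
  set s := coNorm a
  rw [Real.div_rpow (by positivity) (by positivity), Real.div_rpow (by positivity) (by positivity),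
    Real.rpow_sub (by positivity), Real.rpow_sub (by positivity), Real.rpow_neg (by positivity),
    Real.rpow_neg (by positivity), Real.rpow_one, Real.rpow_one,
    show E ^ 2 = E * E by ring, Real.mul_rpow hE.le hE.le]
  field_simp

lemma lintegral_norm_kernelDeriv (hα : -1 < α) (hm : 0 < (n : ℝ) + α) {a : Cn n} (ha : ‖a‖ < 1)
    (ξ : Cn n) :
    ∫⁻ w, ENNReal.ofReal ‖kernelDeriv α a w (involutionDeriv a 0 ξ)‖ ∂(weightedMeasure n α) =
      gradientMass α a ξ := by
  rw [lintegral_comp_ballInvolution hα ha, gradientMass,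
    ← lintegral_const_mul' _ _ ENNReal.ofReal_ne_top]
  refine lintegral_congr_ae ?_
  filter_upwards [ae_weightedMeasure_mem n α] with η hη
  rw [← ENNReal.ofReal_mul (by positivity), ← ENNReal.ofReal_mul (by linarith),
    norm_kernelDeriv_involution hm ha (mem_unitBall.1 hη)]

/-- The gradient pairs bilinearly with `ξ`, so the vector representing the derivative in the
Hermitian pairing is its conjugate. Its length is thus the norm of the functional. -/
lemma fderiv_comp_eq_pairing_invariantGradient (f : Cn n → ℂ) (a ξ : Cn n) :
    fderiv ℂ (fun ω => f (ballInvolution a ω)) 0 ξ =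
      pairing ξ (WithLp.toLp 2 fun j => conj (invariantGradient f a j)) := by
  have : ξ = ∑ j, ξ j • EuclideanSpace.single j (1 : ℂ) := by
    simpa using ((EuclideanSpace.basisFun (Fin n) ℂ).sum_repr ξ).symm
  conv_lhs => rw [this]
  rw [map_sum, pairing, PiLp.inner_apply]
  simp [invariantGradient, complexGradient]

lemma norm_conj_toLp (v : Cn n) :
    ‖(WithLp.toLp 2 fun j => conj (v j) : Cn n)‖ = ‖v‖ := by
  simp [EuclideanSpace.norm_eq]

lemma enorm_invariantGradient_le {f : Cn n → ℂ} {a : Cn n} {C : ℝ≥0∞}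
    (h : ∀ ξ : Cn n, ‖ξ‖ = 1 → ‖fderiv ℂ (fun ω => f (ballInvolution a ω)) 0 ξ‖ₑ ≤ C) :
    ‖invariantGradient f a‖ₑ ≤ C := by
  set v : Cn n := WithLp.toLp 2 fun j => conj (invariantGradient f a j) with hv
  have hn : ‖v‖ = ‖invariantGradient f a‖ := norm_conj_toLp _
  by_cases h0 : v = 0
  · rw [← ofReal_norm, ← hn, h0]; simp
  have hpos : 0 < ‖v‖ := norm_pos_iff.2 h0
  -- The functional attains its norm at the normalized representing vector.
  have := h ((‖v‖⁻¹ : ℂ) • v) (by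
    rw [norm_smul, norm_inv, Complex.norm_real, norm_norm, inv_mul_cancel₀ hpos.ne'])
  rw [fderiv_comp_eq_pairing_invariantGradient, ← hv, pairing_smul_left, pairing_self] at this
  rw [← ofReal_norm, ← hn]
  rw [← ofReal_norm] at this
  refine le_trans (ENNReal.ofReal_le_ofReal (le_of_eq ?_)) this
  rw [norm_mul, norm_inv, Complex.norm_real, Complex.norm_real, norm_norm,
    Real.norm_of_nonneg (by positivity)]
  field_simp

lemma enorm_fderiv_le_invariantGradient (f : Cn n → ℂ) (a : Cn n) {ξ : Cn n} (hξ : ‖ξ‖ = 1) :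
    ‖fderiv ℂ (fun ω => f (ballInvolution a ω)) 0 ξ‖ₑ ≤ ‖invariantGradient f a‖ₑ := by
  rw [fderiv_comp_eq_pairing_invariantGradient, ← ofReal_norm, ← ofReal_norm]
  refine ENNReal.ofReal_le_ofReal ((norm_pairing_le _ _).trans ?_)
  rw [hξ, one_mul, norm_conj_toLp]

lemma enorm_invariantGradient_bergmanProj_le (hα : -1 < α) (hm : 0 < (n : ℝ) + α) {g : Cn n → ℂ}
    (hg : MemLp g ∞ (ballMeasure n)) {a : Cn n} (ha : ‖a‖ < 1) {C : ℝ≥0∞}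
    (hC : ∀ ξ : Cn n, ‖ξ‖ = 1 → gradientMass α a ξ ≤ C) :
    ‖invariantGradient (bergmanProj α g) a‖ₑ ≤ eLpNorm g ∞ (ballMeasure n) * C := by
  refine enorm_invariantGradient_le fun ξ hξ => ?_
  rw [fderiv_bergmanProj_comp hm (integrable_of_memLp_top hα hg) ha]
  refine (enorm_integral_le_lintegral_enorm _).trans ?_
  refine le_trans ?_ (mul_le_mul_right (hC ξ hξ) _)
  rw [← lintegral_norm_kernelDeriv hα hm ha, ← lintegral_const_mul' _ _ hg.2.ne]
  refine lintegral_mono_ae ?_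
  have hess : ∀ᵐ w ∂(weightedMeasure n α), ‖g w‖ₑ ≤ eLpNorm g ∞ (ballMeasure n) :=
    (weightedMeasure_absolutelyContinuous n α).ae_le (ae_le_eLpNormEssSup (f := g))
  filter_upwards [hess] with w hw
  rw [enorm_mul, ofReal_norm]
  gcongr

lemma gradientMass_le_bergmanProjNorm (hα : -1 < α) (hm : 0 < (n : ℝ) + α) {a : Cn n}
    (ha : ‖a‖ < 1) {ξ : Cn n} (hξ : ‖ξ‖ = 1) :
    gradientMass α a ξ ≤ bergmanProjNorm n α := by
  set K : Cn n → ℂ := fun w => kernelDeriv α a w (involutionDeriv a 0 ξ) with hK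
  have hKm : Measurable K := measurable_kernelDeriv_apply _ _
  -- The extremal function makes `g K = |K|`; where `K` vanishes, division by zero sets it to 0.
  set g : Cn n → ℂ := fun w => conj (K w) / ‖K w‖ with hg
  have hgm : Measurable g :=
    (Complex.continuous_conj.measurable.comp hKm).div (Complex.measurable_ofReal.comp hKm.norm)
  have hg1 : ∀ w, ‖g w‖ ≤ 1 := fun w => by
    rw [hg, norm_div, RCLike.norm_conj, Complex.norm_real, norm_norm]
    exact div_self_le_one _
  have hge : eLpNorm g ∞ (ballMeasure n) ≤ 1 := by
    rw [eLpNorm_exponent_top]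
    refine eLpNormEssSup_le_of_ae_enorm_bound (Filter.Eventually.of_forall fun w => ?_)
    rw [← ofReal_norm, ← ENNReal.ofReal_one]
    exact ENNReal.ofReal_le_ofReal (hg1 w)
  have hgL : MemLp g ∞ (ballMeasure n) :=
    ⟨hgm.aestronglyMeasurable, hge.trans_lt ENNReal.one_lt_top⟩
  have hle : ‖fderiv ℂ (fun ω => bergmanProj α g (ballInvolution a ω)) 0 ξ‖ₑ ≤
      bergmanProjNorm n α := by
    refine (enorm_fderiv_le_invariantGradient _ a hξ).trans ?_
    refine le_trans ?_ (le_iSup₂_of_le g hgL (le_iSup_of_le hge le_rfl))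
    exact le_iSup₂_of_le (f := fun z (_ : z ∈ unitBall n) =>
      ‖invariantGradient (bergmanProj α g) z‖ₑ) a (mem_unitBall.2 ha) le_rfl
  have hgi := integrable_of_memLp_top hα hgL
  rw [fderiv_bergmanProj_comp hm hgi ha] at hle
  refine le_trans (le_of_eq ?_) hle
  have hgK : ∀ w, g w * K w = (‖K w‖ : ℂ) := fun w => by
    by_cases h0 : K w = 0
    · simp [hg, h0]
    · have : (‖K w‖ : ℂ) ≠ 0 := by simpa using h0
      simp only [hg]
      rw [div_mul_eq_mul_div, Complex.conj_mul', div_eq_iff this]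
      ring
  have hKi : Integrable (fun w => ‖K w‖) (weightedMeasure n α) := by
    obtain ⟨hi, -⟩ := hasFDerivAt_bergmanProj hm hgi ha
    have h2 := (hi.apply_continuousLinearMap (involutionDeriv a 0 ξ)).norm
    refine h2.congr (Filter.Eventually.of_forall fun w => ?_)
    change ‖g w * K w‖ = ‖K w‖
    rw [hgK, Complex.norm_real, norm_norm]
  have hint : ∫ w, g w * kernelDeriv α a w (involutionDeriv a 0 ξ) ∂(weightedMeasure n α) =
      ((∫ w, ‖K w‖ ∂(weightedMeasure n α) : ℝ) : ℂ) := by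
    rw [← integral_complex_ofReal]
    exact integral_congr_ae (Filter.Eventually.of_forall hgK)
  rw [hint, ← ofReal_norm, Complex.norm_real,
    Real.norm_of_nonneg (integral_nonneg fun _ => norm_nonneg _),
    ofReal_integral_eq_lintegral_ofReal hKi (Filter.Eventually.of_forall fun _ => norm_nonneg _),
    lintegral_norm_kernelDeriv hα hm ha]

end Kernel

/-! ### Boundary points: reduction to `ell` by unitary invariance. -/

section Sphere

variable {n : ℕ} {α : ℝ}

lemma exists_unit_orthogonal (hn : 1 < n) {ζ : Cn n} (hζ : ‖ζ‖ = 1) :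
    ∃ u : Cn n, ‖u‖ = 1 ∧ pairing u ζ = 0 := by
  have ho : Orthonormal ℂ (({⟨0, Nat.zero_lt_of_lt hn⟩} : Set (Fin n)).domRestrict
      fun _ => ζ) := by
    refine ⟨fun _ => hζ, fun i j hij => absurd (Subsingleton.elim i j) hij⟩
  obtain ⟨b, hb⟩ := ho.exists_orthonormalBasis_extension_of_card_eq (by simp)
  refine ⟨b ⟨1, hn⟩, b.norm_eq_one _, ?_⟩
  rw [← hb _ (mem_singleton _)]
  exact b.orthonormal.2 (by simp)

lemma exists_basis_of_orthogonal (hn : 1 < n) {ζ u : Cn n} (hζ : ‖ζ‖ = 1) (hu : ‖u‖ = 1)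
    (h : pairing u ζ = 0) :
    ∃ b : OrthonormalBasis (Fin n) ℂ (Cn n),
      b ⟨0, Nat.zero_lt_of_lt hn⟩ = ζ ∧ b ⟨1, hn⟩ = u := by
  set i₀ : Fin n := ⟨0, Nat.zero_lt_of_lt hn⟩
  set i₁ : Fin n := ⟨1, hn⟩
  have h01 : i₁ ≠ i₀ := by simp [i₀, i₁]
  have h' : pairing ζ u = 0 := by rw [← conj_pairing, h, map_zero]
  have ho : Orthonormal ℂ (({i₀, i₁} : Set (Fin n)).domRestrict
      fun i => if i = i₀ then ζ else u) := by
    refine ⟨?_, ?_⟩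
    · rintro ⟨i, rfl | rfl⟩ <;> simp [hζ, hu, h01]
    · rintro ⟨i, rfl | rfl⟩ ⟨j, rfl | rfl⟩ hij
      · exact absurd rfl hij
      · simpa [h01, pairing] using h
      · simpa [h01, pairing] using h'
      · exact absurd rfl hij
  obtain ⟨b, hb⟩ := ho.exists_orthonormalBasis_extension_of_card_eq (by simp)
  exact ⟨b, by simpa using hb i₀ (by simp), by simpa [h01] using hb i₁ (by simp)⟩

/-- The unit vector `u` must exist even for `x = 0`, when any unit vector orthogonal to `ζ` serves;
this needs `n > 1`. -/
lemma exists_smul_eq_norm_smul_unit (hn : 1 < n) {ζ x : Cn n} (hζ : ‖ζ‖ = 1)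
    (hx : pairing x ζ = 0) (c : ℂ) (hc : ‖c‖ = 1) :
    ∃ u : Cn n, ‖u‖ = 1 ∧ pairing u ζ = 0 ∧ c • x = (‖x‖ : ℂ) • u := by
  by_cases h0 : x = 0
  · obtain ⟨u, hu, hu'⟩ := exists_unit_orthogonal hn hζ
    exact ⟨u, hu, hu', by simp [h0]⟩
  · have hpos : (‖x‖ : ℂ) ≠ 0 := by simpa using h0
    refine ⟨(‖x‖ : ℂ)⁻¹ • c • x, ?_, ?_, ?_⟩
    · rw [norm_smul, norm_smul, hc, norm_inv, Complex.norm_real, norm_norm, one_mul,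
        inv_mul_cancel₀ (norm_ne_zero_iff.2 h0)]
    · rw [pairing_smul_left, pairing_smul_left, hx, mul_zero, mul_zero]
    · rw [smul_smul, mul_inv_cancel₀ hpos, one_smul]

lemma exists_unimodular (c : ℂ) : ∃ u : ℂ, ‖u‖ = 1 ∧ c = -(u * ‖c‖) := by
  by_cases h : c = 0
  · exact ⟨1, by simp, by simp [h]⟩
  · have : (‖c‖ : ℂ) ≠ 0 := by simpa using h
    refine ⟨-(c / ‖c‖), ?_, by field_simp⟩
    rw [norm_neg, norm_div, Complex.norm_real, norm_norm, div_self (norm_ne_zero_iff.2 h)]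

/-- At boundary points the gradient mass is one of the values of `ell`. -/
lemma gradientMass_sphere (hn : 1 < n) (hα : -1 < α) {ζ ξ : Cn n} (hζ : ‖ζ‖ = 1)
    (hξ : ‖ξ‖ = 1) :
    ∃ t ∈ Icc 0 (Real.pi / 2), gradientMass α ζ ξ = ENNReal.ofReal (ell hn α t) := by
  set c := pairing ξ ζ with hc
  set x := ξ - c • ζ with hx
  have hζζ : pairing ζ ζ = 1 := by rw [pairing_self, hζ]; simp
  have hxζ : pairing x ζ = 0 := by
    rw [hx, pairing_sub_left, pairing_smul_left, hζζ, ← hc]; ring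
  have hc1 : ‖c‖ ≤ 1 := by
    have := norm_pairing_le ξ ζ
    rwa [hζ, hξ, mul_one] at this
  have hnorm : ‖c‖ ^ 2 + ‖x‖ ^ 2 = 1 := by
    have h1 : pairing ξ ξ = ((‖c‖ ^ 2 + ‖x‖ ^ 2 : ℝ) : ℂ) := by
      have hζx : pairing ζ x = 0 := by rw [← conj_pairing, hxζ, map_zero]
      have hξx : ξ = c • ζ + x := by rw [hx]; abel
      conv_lhs => rw [hξx]
      rw [pairing_add_left, pairing_add_right, pairing_add_right, pairing_smul_left,
        pairing_smul_left, pairing_smul_right, pairing_smul_right, hζζ, hζx, hxζ, pairing_self,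
        mul_one, Complex.mul_conj']
      push_cast
      ring
    rw [pairing_self, hξ] at h1
    have h1 : (1 : ℝ) ^ 2 = ‖c‖ ^ 2 + ‖x‖ ^ 2 := Complex.ofReal_injective h1
    linarith
  -- The sign in `conj c = -v|c|` turns `conj c (⟨η,ζ⟩ - 1)` into `v|c|(1 - ⟨η,ζ⟩)`. Choosing `u`
  -- with `v x = |x| u` then lets `v` be factored out of `⟨η - ζ, ξ⟩`.
  obtain ⟨v, hv, hcv⟩ := exists_unimodular (conj c)
  rw [RCLike.norm_conj] at hcv
  obtain ⟨u, hu, huζ, hxu⟩ := exists_smul_eq_norm_smul_unit hn hζ hxζ v hv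
  obtain ⟨b, hb0, hb1⟩ := exists_basis_of_orthogonal hn hζ hu huζ
  refine ⟨Real.arccos ‖c‖, ⟨Real.arccos_nonneg _, Real.arccos_le_pi_div_two.2 (norm_nonneg _)⟩, ?_⟩
  have hcos : Real.cos (Real.arccos ‖c‖) = ‖c‖ :=
    Real.cos_arccos (by linarith [norm_nonneg c]) hc1
  have hsin : Real.sin (Real.arccos ‖c‖) = ‖x‖ := by
    rw [Real.sin_arccos, ← Real.sqrt_sq (norm_nonneg x)]
    congr 1
    linarith
  have hmp := measurePreserving_weightedMeasure hα b.repr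
  rw [ofReal_ell hn hα, gradientMass,
    ← hmp.lintegral_comp (f := fun w => ENNReal.ofReal (ellIntegrand hn α _ w))
      (measurable_ellIntegrand hn α _).ennreal_ofReal]
  congr 1
  refine lintegral_congr fun η => ?_
  congr 1
  have e0 : b.repr η ⟨0, Nat.zero_lt_of_lt hn⟩ = pairing η ζ := by
    rw [b.repr_apply_apply, hb0]; rfl
  have e1 : b.repr η ⟨1, hn⟩ = pairing η u := by
    rw [b.repr_apply_apply, hb1]; rfl
  rw [ellIntegrand, e0, e1, hcos, hsin, norm_sub_rev (pairing η ζ)]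
  congr 1
  have hvv : v * conj v = 1 := by rw [Complex.mul_conj', hv]; simp
  have hζx : pairing ζ x = 0 := by rw [← conj_pairing, hxζ, map_zero]
  have key : pairing (η - ζ) ξ =
      v * ((1 - pairing η ζ) * (‖c‖ : ℂ) + pairing η u * (‖x‖ : ℂ)) := by
    have h1 : conj v * pairing η x = (‖x‖ : ℂ) * pairing η u := by
      rw [← pairing_smul_right, hxu, pairing_smul_right, Complex.conj_ofReal]
    have hξx : ξ = c • ζ + x := by rw [hx]; abel
    rw [hξx, pairing_sub_left, pairing_add_right, pairing_add_right, pairing_smul_right,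
      pairing_smul_right, hζζ, hζx, hcv]
    linear_combination v * h1 - pairing η x * hvv
  rw [key, norm_mul, hv, one_mul]

/-! ### From the ball to the sphere and back. -/

/-- The integrand of `gradientMass`. -/
def massIntegrand (α : ℝ) (ξ a η : Cn n) : ℝ :=
  ‖pairing (η - a) ξ‖ / ‖1 - pairing η a‖ ^ ((n : ℝ) + 1 + α)

lemma gradientMass_eq (a ξ : Cn n) : gradientMass α a ξ = ENNReal.ofReal (n + 1 + α) *
    ∫⁻ η, ENNReal.ofReal (massIntegrand α ξ a η) ∂(weightedMeasure n α) := rfl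

lemma norm_add_smul_sq {a u : Cn n} (hu : ‖u‖ = 1) (hau : pairing u a = 0) (l : ℂ) :
    ‖a + l • u‖ ^ 2 = ‖a‖ ^ 2 + ‖l‖ ^ 2 := by
  have hua : pairing a u = 0 := by rw [← conj_pairing, hau, map_zero]
  have h := pairing_self (a + l • u)
  rw [pairing_add_left, pairing_add_right, pairing_add_right, pairing_smul_left,
    pairing_smul_left, pairing_smul_right, pairing_smul_right, hau, hua, pairing_self, pairing_self,
    hu] at h
  apply Complex.ofReal_injective
  rw [← h]
  push_cast
  rw [← Complex.mul_conj' l]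
  ring

/-- The sub-mean value property of the integrand of `gradientMass` in its base point. -/
lemma ofReal_massIntegrand_le_circle {a u η ξ : Cn n} {R : ℝ}
    (hR : ∀ l : ℂ, ‖l‖ ≤ |R| → ‖a + l • u‖ ≤ 1) (hη : ‖η‖ < 1) :
    ENNReal.ofReal (massIntegrand α ξ a η) ≤ ENNReal.ofReal (2 * Real.pi)⁻¹ *
      ∫⁻ θ in Ioc 0 (2 * Real.pi),
        ENNReal.ofReal (massIntegrand α ξ (a + circleMap 0 R θ • u) η) := by
  -- Replacing `⟨η, a⟩` by its conjugate keeps the modulus and makes the function holomorphic in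
  -- `l`; `1 - ⟨a + l u, η⟩` stays in the slit plane because `‖η‖ < 1`.
  set h : ℂ → ℂ := fun l => pairing (η - (a + l • u)) ξ *
    (1 - pairing (a + l • u) η) ^ (-((n : ℂ) + 1 + α)) with hh
  have hnorm : ∀ l : ℂ, ‖h l‖ = massIntegrand α ξ (a + l • u) η := by
    intro l
    rw [hh, norm_mul, show -((n : ℂ) + 1 + α) = ((-((n : ℝ) + 1 + α) : ℝ) : ℂ) by push_cast; rfl,
      Complex.norm_cpow_real, Real.rpow_neg (norm_nonneg _), massIntegrand, div_eq_mul_inv,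
      norm_one_sub_pairing_comm η]
  have hd : DiffContOnCl ℂ h (Metric.ball 0 |R|) := by
    refine DifferentiableOn.diffContOnCl fun l hl => ?_
    have hl : ‖l‖ ≤ |R| := mem_closedBall_zero_iff.1 (Metric.closure_ball_subset_closedBall hl)
    have hs := one_sub_mem_slitPlane (norm_pairing_lt_one (hR l hl) hη)
    have hp : ∀ y : Cn n, Differentiable ℂ fun x : Cn n => pairing x y :=
      fun y => (innerSL ℂ y).differentiable
    have h1 : Differentiable ℂ fun l : ℂ => a + l • u := by fun_prop
    have h2 : Differentiable ℂ fun l : ℂ => pairing (η - (a + l • u)) ξ :=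
      (hp ξ).comp (h1.const_sub η)
    have h3 : DifferentiableAt ℂ (fun l : ℂ => 1 - pairing (a + l • u) η) l :=
      (((hp η).comp h1).const_sub 1) l
    exact ((h2 l).mul (h3.cpow_const hs)).differentiableWithinAt
  have havg := hd.circleAverage
  rw [Real.circleAverage_def, intervalIntegral.integral_of_le (by positivity)] at havg
  have h0 : massIntegrand α ξ a η = ‖h 0‖ := by rw [hnorm, zero_smul, add_zero]
  rw [h0, ofReal_norm, ← havg, enorm_smul, Real.enorm_of_nonneg (by positivity)]
  gcongr
  refine (enorm_integral_le_lintegral_enorm _).trans (le_of_eq ?_)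
  refine lintegral_congr fun θ => ?_
  rw [← ofReal_norm, hnorm]

lemma gradientMass_le_of_sphere (hn : 1 < n) (hα : -1 < α) {a ξ : Cn n} (ha : ‖a‖ < 1)
    {C : ℝ≥0∞} (hC : ∀ ζ : Cn n, ‖ζ‖ = 1 → gradientMass α ζ ξ ≤ C) : gradientMass α a ξ ≤ C := by
  have := isProbabilityMeasure_weightedMeasure (n := n) hα
  obtain ⟨u, hu, hua⟩ : ∃ u : Cn n, ‖u‖ = 1 ∧ pairing u a = 0 := by
    by_cases h0 : a = 0
    · exact ⟨EuclideanSpace.single ⟨0, Nat.zero_lt_of_lt hn⟩ 1, by simp, by simp [h0]⟩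
    · obtain ⟨u, hu, hua⟩ := exists_unit_orthogonal hn (ζ := (‖a‖⁻¹ : ℂ) • a) (by
        rw [norm_smul, norm_inv, Complex.norm_real, norm_norm,
          inv_mul_cancel₀ (norm_ne_zero_iff.2 h0)])
      refine ⟨u, hu, ?_⟩
      rw [pairing_smul_right] at hua
      exact (mul_eq_zero.1 hua).resolve_left (by simpa using h0)
  -- Since `u` is orthogonal to `a`, the choice `R² = 1 - ‖a‖²` puts the whole circle `a + R e^{iθ}
  -- u` on the sphere.
  set R := coNorm a
  have hRpos : 0 < R := coNorm_pos ha
  have hR2 : R ^ 2 = 1 - ‖a‖ ^ 2 := coNorm_sq ha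
  have hR : ∀ l : ℂ, ‖l‖ ≤ |R| → ‖a + l • u‖ ≤ 1 := by
    intro l hl
    rw [abs_of_pos hRpos] at hl
    have := norm_add_smul_sq hu hua l
    have h2 : ‖l‖ ^ 2 ≤ R ^ 2 := by gcongr
    exact abs_le_one_iff_mul_self_le_one.2 (by nlinarith) |> (le_trans (le_abs_self _))
  have hsphere : ∀ θ, ‖a + circleMap 0 R θ • u‖ = 1 := by
    intro θ
    have := norm_add_smul_sq hu hua (circleMap 0 R θ)
    rw [norm_circleMap_zero, sq_abs, hR2] at this
    nlinarith [norm_nonneg (a + circleMap 0 R θ • u)]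
  rw [gradientMass_eq]
  calc ENNReal.ofReal (n + 1 + α) *
        ∫⁻ η, ENNReal.ofReal (massIntegrand α ξ a η) ∂(weightedMeasure n α)
      ≤ ENNReal.ofReal (n + 1 + α) * ∫⁻ η, ENNReal.ofReal (2 * Real.pi)⁻¹ *
          (∫⁻ θ in Ioc 0 (2 * Real.pi),
            ENNReal.ofReal (massIntegrand α ξ (a + circleMap 0 R θ • u) η))
              ∂(weightedMeasure n α) := by
        gcongr _ * ?_
        refine lintegral_mono_ae ?_
        filter_upwards [ae_weightedMeasure_mem n α] with η hη
        exact ofReal_massIntegrand_le_circle hR (mem_unitBall.1 hη)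
    _ = ENNReal.ofReal (2 * Real.pi)⁻¹ * ∫⁻ θ in Ioc 0 (2 * Real.pi),
          gradientMass α (a + circleMap 0 R θ • u) ξ := by
        have hmeas : Measurable fun p : Cn n × ℝ =>
            ENNReal.ofReal (massIntegrand α ξ (a + circleMap 0 R p.2 • u) p.1) := by
          have hcm : Measurable fun p : Cn n × ℝ => circleMap 0 R p.2 :=
            (continuous_circleMap 0 R).measurable.comp measurable_snd
          unfold massIntegrand pairing
          fun_prop
        rw [lintegral_const_mul' _ _ ENNReal.ofReal_ne_top,
          lintegral_lintegral_swap hmeas.aemeasurable]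
        simp only [gradientMass_eq]
        rw [lintegral_const_mul' _ _ ENNReal.ofReal_ne_top]
        ring
    _ ≤ ENNReal.ofReal (2 * Real.pi)⁻¹ * ∫⁻ θ in Ioc 0 (2 * Real.pi), C := by
        gcongr with θ
        exact hC _ (hsphere θ)
    _ = C := by
        rw [setLIntegral_const, Real.volume_Ioc, sub_zero, mul_left_comm,
          ← ENNReal.ofReal_mul (by positivity), inv_mul_cancel₀ (by positivity),
          ENNReal.ofReal_one, mul_one]

lemma tendsto_massIntegrand (ξ : Cn n) {ζ η : Cn n} (hζ : ‖ζ‖ = 1) (hη : ‖η‖ < 1) :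
    Tendsto (fun k : ℕ => massIntegrand α ξ (((1 - 1 / ((k : ℝ) + 1) : ℝ) : ℂ) • ζ) η) atTop
      (𝓝 (massIntegrand α ξ ζ η)) := by
  have h0 : Tendsto (fun k : ℕ => (((1 - 1 / ((k : ℝ) + 1) : ℝ) : ℂ) • ζ)) atTop (𝓝 ζ) := by
    have h1 : Tendsto (fun k : ℕ => (1 - 1 / ((k : ℝ) + 1) : ℝ)) atTop (𝓝 (1 - 0)) :=
      tendsto_const_nhds.sub tendsto_one_div_add_atTop_nhds_zero_nat
    have h2 := ((Complex.continuous_ofReal.tendsto _).comp h1).smul_const ζ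
    simpa using h2
  have hne : ‖1 - pairing η ζ‖ ≠ 0 :=
    norm_ne_zero_iff.2 (one_sub_pairing_ne_zero' hη hζ.le)
  have hc : ContinuousAt (fun a => massIntegrand α ξ a η) ζ := by
    have h1 : Continuous fun a : Cn n => ‖pairing (η - a) ξ‖ := by unfold pairing; fun_prop
    have h2 : Continuous fun a : Cn n => ‖1 - pairing η a‖ := by unfold pairing; fun_prop
    refine h1.continuousAt.div (h2.continuousAt.rpow_const (Or.inl hne)) ?_
    exact (Real.rpow_pos_of_pos (lt_of_le_of_ne (norm_nonneg _) hne.symm) _).ne'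
  exact hc.tendsto.comp h0

/-- Only an upper bound for the boundary value is needed, so Fatou's lemma along a radius suffices.
-/
lemma gradientMass_sphere_le_bergmanProjNorm (hα : -1 < α) (hm : 0 < (n : ℝ) + α) {ζ ξ : Cn n}
    (hζ : ‖ζ‖ = 1) (hξ : ‖ξ‖ = 1) : gradientMass α ζ ξ ≤ bergmanProjNorm n α := by
  set r : ℕ → ℝ := fun k => 1 - 1 / ((k : ℝ) + 1) with hr
  have hr1 : ∀ k, ‖((r k : ℝ) : ℂ) • ζ‖ < 1 := fun k => by
    have h1 : 0 < 1 / ((k : ℝ) + 1) := Nat.one_div_pos_of_nat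
    have h2 : 1 / ((k : ℝ) + 1) ≤ 1 := by
      rw [div_le_one (by positivity)]
      linarith [(k.cast_nonneg : (0 : ℝ) ≤ k)]
    rw [norm_smul, hζ, mul_one, Complex.norm_real, Real.norm_of_nonneg (by simp only [hr]; linarith)]
    simp only [hr]
    linarith
  have hmeas : ∀ a : Cn n, Measurable fun η => ENNReal.ofReal (massIntegrand α ξ a η) := by
    intro a
    unfold massIntegrand pairing
    fun_prop
  have hN : ENNReal.ofReal ((n : ℝ) + 1 + α) ≠ 0 := by
    simp only [ne_eq, ENNReal.ofReal_eq_zero, not_le]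
    linarith
  have hle : ∀ k, ∫⁻ η, ENNReal.ofReal (massIntegrand α ξ (((r k : ℝ) : ℂ) • ζ) η)
      ∂(weightedMeasure n α) ≤ bergmanProjNorm n α / ENNReal.ofReal ((n : ℝ) + 1 + α) := by
    intro k
    rw [ENNReal.le_div_iff_mul_le (Or.inl hN) (Or.inl ENNReal.ofReal_ne_top), mul_comm]
    exact gradientMass_le_bergmanProjNorm hα hm (hr1 k) hξ
  have hfatou : ∫⁻ η, ENNReal.ofReal (massIntegrand α ξ ζ η) ∂(weightedMeasure n α) ≤
      bergmanProjNorm n α / ENNReal.ofReal ((n : ℝ) + 1 + α) := by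
    calc ∫⁻ η, ENNReal.ofReal (massIntegrand α ξ ζ η) ∂(weightedMeasure n α)
        = ∫⁻ η, liminf (fun k => ENNReal.ofReal (massIntegrand α ξ (((r k : ℝ) : ℂ) • ζ) η)) atTop
            ∂(weightedMeasure n α) := by
          refine lintegral_congr_ae ?_
          filter_upwards [ae_weightedMeasure_mem n α] with η hη
          exact ((ENNReal.continuous_ofReal.tendsto _).comp
            (tendsto_massIntegrand ξ hζ (mem_unitBall.1 hη))).liminf_eq.symm
      _ ≤ liminf (fun k => ∫⁻ η, ENNReal.ofReal (massIntegrand α ξ (((r k : ℝ) : ℂ) • ζ) η)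
            ∂(weightedMeasure n α)) atTop := lintegral_liminf_le fun k => hmeas _
      _ ≤ bergmanProjNorm n α / ENNReal.ofReal ((n : ℝ) + 1 + α) :=
          (liminf_le_liminf (Eventually.of_forall hle)).trans (liminf_const _).le
  rw [ENNReal.le_div_iff_mul_le (Or.inl hN) (Or.inl ENNReal.ofReal_ne_top), mul_comm] at hfatou
  exact hfatou

/-- The boundary point `e₀` and the direction `-cos t e₀ + sin t e₁` reproduce the integrand of
`ell`. -/
lemma ofReal_ell_le_bergmanProjNorm (hn : 1 < n) (hα : -1 < α) (t : ℝ) :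
    ENNReal.ofReal (ell hn α t) ≤ bergmanProjNorm n α := by
  have hm := add_pos_of_one_lt hn hα
  set i₀ : Fin n := ⟨0, Nat.zero_lt_of_lt hn⟩
  set i₁ : Fin n := ⟨1, hn⟩
  have h01 : i₁ ≠ i₀ := by simp [i₀, i₁]
  set e₀ : Cn n := EuclideanSpace.single i₀ 1
  set e₁ : Cn n := EuclideanSpace.single i₁ 1
  have p0 : ∀ w : Cn n, pairing w e₀ = w i₀ := fun w => by
    simp [pairing, e₀, EuclideanSpace.inner_single_left]
  have p1 : ∀ w : Cn n, pairing w e₁ = w i₁ := fun w => by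
    simp [pairing, e₁, EuclideanSpace.inner_single_left]
  have he0 : ‖e₀‖ = 1 := by simp [e₀]
  have he1 : ‖e₁‖ = 1 := by simp [e₁]
  have hx : ∀ w : Cn n, pairing (w - e₀) (-(Real.cos t : ℂ) • e₀ + (Real.sin t : ℂ) • e₁) =
      (1 - w i₀) * (Real.cos t : ℂ) + w i₁ * (Real.sin t : ℂ) := by
    intro w
    rw [pairing_add_right, pairing_smul_right, pairing_smul_right, p0, p1, map_neg,
      Complex.conj_ofReal, Complex.conj_ofReal]
    simp [e₀, h01]
    ring
  have hξ : ‖-(Real.cos t : ℂ) • e₀ + (Real.sin t : ℂ) • e₁‖ = 1 := by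
    have h := norm_add_smul_sq (a := -(Real.cos t : ℂ) • e₀) he1
      (by rw [pairing_smul_right, p0]; simp [e₁, h01.symm]) (Real.sin t : ℂ)
    rw [norm_smul, he0, mul_one, norm_neg, Complex.norm_real, Complex.norm_real, Real.norm_eq_abs,
      Real.norm_eq_abs, sq_abs, sq_abs, Real.cos_sq_add_sin_sq] at h
    exact (pow_eq_one_iff_of_nonneg (norm_nonneg _) two_ne_zero).1 h
  refine le_trans (le_of_eq ?_) (gradientMass_sphere_le_bergmanProjNorm hα hm he0 hξ)
  rw [ofReal_ell hn hα, gradientMass]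
  simp only [hx, p0, norm_sub_rev (1 : ℂ)]
  rfl

/-! ### The norm formula and the Bloch property. -/

lemma invariantBlochSeminorm_bergmanProj_le (hn : 1 < n) (hα : -1 < α) {t₀ : ℝ}
    (ht₀ : IsMaxOn (ell hn α) (Icc 0 (Real.pi / 2)) t₀) {g : Cn n → ℂ}
    (hg : MemLp g ∞ (ballMeasure n)) :
    invariantBlochSeminorm (bergmanProj α g) ≤
      eLpNorm g ∞ (ballMeasure n) * ENNReal.ofReal (ell hn α t₀) := by
  refine iSup₂_le fun a ha => ?_
  refine enorm_invariantGradient_bergmanProj_le hα (add_pos_of_one_lt hn hα) hg (mem_unitBall.1 ha)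
    fun ξ hξ => gradientMass_le_of_sphere hn hα (mem_unitBall.1 ha) fun ζ hζ => ?_
  obtain ⟨t, ht, h⟩ := gradientMass_sphere hn hα hζ hξ
  rw [h]
  exact ENNReal.ofReal_le_ofReal (ht₀ ht)

lemma bergmanProjNorm_eq (hn : 1 < n) (hα : -1 < α) {t₀ : ℝ}
    (ht₀ : IsMaxOn (ell hn α) (Icc 0 (Real.pi / 2)) t₀) :
    bergmanProjNorm n α = ENNReal.ofReal (ell hn α t₀) := by
  refine le_antisymm ?_ (ofReal_ell_le_bergmanProjNorm hn hα t₀)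
  refine iSup_le fun g => iSup_le fun hg => iSup_le fun hg1 => ?_
  refine (invariantBlochSeminorm_bergmanProj_le hn hα ht₀ hg).trans ?_
  exact (mul_le_mul_left hg1 _).trans_eq (one_mul _)

lemma memBloch_bergmanProj (hn : 1 < n) (hα : -1 < α) {t₀ : ℝ}
    (ht₀ : IsMaxOn (ell hn α) (Icc 0 (Real.pi / 2)) t₀) {g : Cn n → ℂ}
    (hg : MemLp g ∞ (ballMeasure n)) : MemBloch (bergmanProj α g) := by
  refine ⟨fun z hz => ?_, ?_⟩
  · exact (hasFDerivAt_bergmanProj (add_pos_of_one_lt hn hα) (integrable_of_memLp_top hα hg)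
      (mem_unitBall.1 hz)).2.differentiableAt.differentiableWithinAt
  · exact (invariantBlochSeminorm_bergmanProj_le hn hα ht₀ hg).trans_lt
      (ENNReal.mul_lt_top hg.2 ENNReal.ofReal_lt_top)

end Sphere

end BergmanBloch

end

theorem theorem2 (n : ℕ) (hn : 1 < n) (α : ℝ) (hα : -1 < α) :
    (BergmanBloch.ell hn α (Real.pi / 2) = Real.pi / 2 * BergmanBloch.ell hn α 0 ∧
      Real.pi / 2 * BergmanBloch.ell hn α 0 = Real.pi / 2 * BergmanBloch.blochConst n α) ∧
    (∀ g : BergmanBloch.Cn n → ℂ, MemLp g ∞ (BergmanBloch.ballMeasure n) →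
      BergmanBloch.MemBloch (BergmanBloch.bergmanProj α g)) ∧
    BergmanBloch.bergmanProjNorm n α ≠ ∞ ∧
    IsGreatest (BergmanBloch.ell hn α '' Set.Icc 0 (Real.pi / 2))
      (BergmanBloch.bergmanProjNorm n α).toReal ∧
    Real.pi / 2 * BergmanBloch.blochConst n α ≤ (BergmanBloch.bergmanProjNorm n α).toReal ∧
    (BergmanBloch.bergmanProjNorm n α).toReal ≤
      Real.sqrt (Real.pi ^ 2 + 4) / 2 * BergmanBloch.blochConst n α := by
  have h0 := BergmanBloch.ell_zero hn hα
  have h1 := BergmanBloch.ell_pi_div_two hn hα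
  obtain ⟨t₀, ht₀, hmax⟩ := isCompact_Icc.exists_isMaxOn
    (Set.nonempty_Icc.2 (by positivity : (0 : ℝ) ≤ Real.pi / 2))
    (BergmanBloch.continuous_ell hn hα).continuousOn
  have hnorm := BergmanBloch.bergmanProjNorm_eq hn hα hmax
  have hreal : (BergmanBloch.bergmanProjNorm n α).toReal = BergmanBloch.ell hn α t₀ := by
    rw [hnorm, ENNReal.toReal_ofReal (BergmanBloch.ell_nonneg hn hα t₀)]
  refine ⟨⟨by rw [h1, h0], by rw [h0]⟩,
    fun g hg => BergmanBloch.memBloch_bergmanProj hn hα hmax hg, ?_, ?_, ?_, ?_⟩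
  · rw [hnorm]; exact ENNReal.ofReal_ne_top
  · rw [hreal]
    refine ⟨⟨t₀, ht₀, rfl⟩, ?_⟩
    rintro _ ⟨t, ht, rfl⟩
    exact hmax ht
  · rw [hreal, ← h1]
    exact hmax ⟨by positivity, le_rfl⟩
  · rw [hreal]
    exact BergmanBloch.ell_le hn hα t₀
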